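/- All algebras and tensor products are over $\mathbb C$, algebras need not be unital, $V'$ is the algebraic dual of a vector space $V$, and $\iota$ denotes identity maps. An algebra $B$ is non-degenerate if $bB=0$ implies $b=0$ and $Bb=0$ implies $b=0$; $M(B)$ denotes its multiplier algebra, in which $B$ is embedded as a two-sided ideal. A homomorphism $\pi:B\to M(C)$ is non-degenerate if $\pi(B)C$ and $C\pi(B)$ span $C$; it then has a unique multiplicative linear extension $M(B)\to M(C)$, again denoted $\pi$. Let $(A,\Delta)$ be an algebraic quantum group: $A$ is a non-degenerate algebra, $\Delta:A\to M(A\odot A)$ is a non-degenerate homomorphism with $(\Delta\odot\iota)\Delta=(\iota\odot\Delta)\Delta$, the four maps sending $a\otimes b$ to $\Delta(a)(b\otimes1)$, $\Delta(a)(1\otimes b)$, $(b\otimes1)\Delta(a)$, $(1\otimes b)\Delta(a)$ are linear bijections from $A\odot A$ onto $A\odot A$, and there is a non-zero functional $\varphi\in A'$ that is left invariant, i.e. $(\iota\odot\varphi)\Delta(a)=\varphi(a)1$ for all $a\in A$. Fix such a $\varphi$. For $a\in A$ and $\omega\in A'$ let $a\omega\in A'$ be given by $(a\omega)(x)=\omega(xa)$,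 and let $\hat A=\{a\varphi\mid a\in A\}\subseteq A'$, an algebra under the product $(\omega_1\omega_2)(x)=\omega_1\bigl((\iota\odot\omega_2)\Delta(x)\bigr)$; here, for $\omega_2\in\hat A$, $(\iota\odot\omega_2)\Delta(x)$ is the element $y\in A$ with $yb=(\iota\odot\omega_2)(\Delta(x)(b\otimes1))$ and $by=(\iota\odot\omega_2)((b\otimes1)\Delta(x))$ for all $b\in A$. Regard elements of $A\odot\hat A$ as linear operators on $A$ through $(x\otimes\omega)(y)=\omega(y)\,x$. For a non-degenerate algebra $B$, a corepresentation of $(A,\Delta)$ on $B$ is an element $V\in M(A\odot B)$ with $(\Delta\odot\iota)(V)=V_{13}V_{23}$; it is called non-degenerate if $V$ is invertible in $M(A\odot B)$. For $V\in M(A\odot B)$ and $\theta$ in the linear span of $\{a\omega\mid a\in A,\ \omega\in A'\}$, the left multiplier $(\theta\odot\iota)(V)$ of $B$ is defined by linearity in $\theta$ and $((a\omega)\odot\iota)(V)\,b=(\omega\odot\iota)(V(a\otimes b))$ for $b\in B$; for a corepresentation $V$ on $B$ let $\pi_V(\omega)=(\omega\odot\iota)(V)\in M(B)$ for $\omega\in\hat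 A$. Then there is a unique element $U\in M(A\odot\hat A)$ such that, for all $x,y\in A$ and $\omega\in\hat A$, $$[U(x\otimes\omega)](y)=(\iota\odot\omega)\bigl(\Delta(y)(x\otimes1)\bigr)\quad\text{and}\quad[(x\otimes\omega)U](y)=(\omega\odot\iota)\bigl((1\otimes x)\Delta(y)\bigr).$$ This element $U$, the universal corepresentation of $(A,\Delta)$, is invertible in $M(A\odot\hat A)$ and satisfies $(\Delta\odot\iota)(U)=U_{13}U_{23}$, so it is a non-degenerate corepresentation of $(A,\Delta)$ on $\hat A$. Moreover $\pi_U=\iota$, that is, $(\omega\odot\iota)(U)=\omega$ for every $\omega\in\hat A$. -/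

import Mathlib

open scoped TensorProduct

set_option linter.unusedSectionVars false

namespace QuantumGroup

/-! ### Non-degenerate algebras and their multiplier algebras -/

section Multiplier

variable (X : Type*) [NonUnitalRing X] [Module ℂ X] [IsScalarTower ℂ X X] [SMulCommClass ℂ X X]

/-- A (not necessarily unital) algebra is non-degenerate if its product is non-degenerate. -/
structure IsNondegenerate : Prop where
  eq_zero_of_mul_right : ∀ a : X, (∀ b, a * b = 0) → a = 0
  eq_zero_of_mul_left : ∀ a : X, (∀ b, b * a = 0) → a = 0

/-- The multiplier algebra `M(X)`: pairs `(L, R)`, where `L x` is the product `m x` and `R x`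
is the product `x m` of `x` with the multiplier `m`. The product of `(L, R)` and `(L', R')` is
`(L ∘ L', R' ∘ R)`, whence the opposite algebra in the second component. -/
def multiplierAlgebra : Subalgebra ℂ (Module.End ℂ X × (Module.End ℂ X)ᵐᵒᵖ) where
  carrier := {m | (∀ a b, m.1 (a * b) = m.1 a * b) ∧
    (∀ a b, m.2.unop (a * b) = a * m.2.unop b) ∧ ∀ a b, a * m.1 b = m.2.unop a * b}
  mul_mem' := by
    rintro m n ⟨h1, h2, h3⟩ ⟨k1, k2, k3⟩
    refine ⟨fun a b => ?_, fun a b => ?_, fun a b => ?_⟩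
    · simp [h1, k1]
    · simp [h2, k2]
    · simp [h3, k3]
  add_mem' := by
    rintro m n ⟨h1, h2, h3⟩ ⟨k1, k2, k3⟩
    refine ⟨fun a b => ?_, fun a b => ?_, fun a b => ?_⟩
    · simp [h1, k1, add_mul]
    · simp [h2, k2, mul_add]
    · simp [h3, k3, mul_add, add_mul]
  algebraMap_mem' := by
    intro r
    refine ⟨fun a b => (smul_mul_assoc r a b).symm, fun a b => (mul_smul_comm r a b).symm,
      fun a b => ?_⟩
    exact (mul_smul_comm r a b).trans (smul_mul_assoc r a b).symm

/-- The multiplier algebra as a type. -/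
abbrev Mult : Type _ := multiplierAlgebra X

instance : NonUnitalNonAssocSemiring (Mult X) := inferInstance

variable {X}

namespace Mult

/-- Left multiplication `x ↦ m x` by a multiplier `m`. -/
def lmul (m : Mult X) : X →ₗ[ℂ] X := m.1.1

/-- Right multiplication `x ↦ x m` by a multiplier `m`. -/
def rmul (m : Mult X) : X →ₗ[ℂ] X := m.1.2.unop

/-- The multiplier with given left and right multiplications. -/
def mk (L R : X →ₗ[ℂ] X) (hL : ∀ a b, L (a * b) = L a * b) (hR : ∀ a b, R (a * b) = a * R b)
    (h : ∀ a b, a * L b = R a * b) : Mult X :=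
  ⟨(L, MulOpposite.op R), hL, hR, h⟩

@[simp] lemma lmul_mk (L R : X →ₗ[ℂ] X) (hL hR h) : (mk L R hL hR h).lmul = L := rfl
@[simp] lemma rmul_mk (L R : X →ₗ[ℂ] X) (hL hR h) : (mk L R hL hR h).rmul = R := rfl

@[ext] lemma ext {m n : Mult X} (hl : ∀ x, m.lmul x = n.lmul x) (hr : ∀ x, m.rmul x = n.rmul x) :
    m = n :=
  Subtype.ext (Prod.ext (LinearMap.ext hl) (MulOpposite.unop_injective (LinearMap.ext hr)))

lemma lmul_mul (m : Mult X) (a b : X) : m.lmul (a * b) = m.lmul a * b := m.2.1 a b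
lemma rmul_mul (m : Mult X) (a b : X) : m.rmul (a * b) = a * m.rmul b := m.2.2.1 a b
lemma mul_lmul (m : Mult X) (a b : X) : a * m.lmul b = m.rmul a * b := m.2.2.2 a b

@[simp] lemma mul_lmul_apply (m n : Mult X) (x : X) : (m * n).lmul x = m.lmul (n.lmul x) := rfl
@[simp] lemma mul_rmul_apply (m n : Mult X) (x : X) : (m * n).rmul x = n.rmul (m.rmul x) := rfl
@[simp] lemma one_lmul (x : X) : (1 : Mult X).lmul x = x := rfl
@[simp] lemma one_rmul (x : X) : (1 : Mult X).rmul x = x := rfl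
@[simp] lemma add_lmul (m n : Mult X) (x : X) : (m + n).lmul x = m.lmul x + n.lmul x := rfl
@[simp] lemma add_rmul (m n : Mult X) (x : X) : (m + n).rmul x = m.rmul x + n.rmul x := rfl
@[simp] lemma smul_lmul (c : ℂ) (m : Mult X) (x : X) : (c • m).lmul x = c • m.lmul x := rfl
@[simp] lemma smul_rmul (c : ℂ) (m : Mult X) (x : X) : (c • m).rmul x = c • m.rmul x := rfl
@[simp] lemma zero_lmul (x : X) : (0 : Mult X).lmul x = 0 := rfl
@[simp] lemma zero_rmul (x : X) : (0 : Mult X).rmul x = 0 := rfl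

/-- For a non-degenerate algebra a multiplier is determined by its left multiplication. -/
lemma ext_left (hX : IsNondegenerate X) {m n : Mult X} (h : ∀ x, m.lmul x = n.lmul x) :
    m = n := by
  refine ext h fun x => sub_eq_zero.1 (hX.eq_zero_of_mul_right _ fun b => ?_)
  rw [sub_mul, ← mul_lmul, ← mul_lmul, h, sub_self]

variable (X) in
/-- The canonical map of `X` into `M(X)` (an embedding if `X` is non-degenerate). -/
def incl : X →ₙₐ[ℂ] Mult X where
  toFun x := mk (LinearMap.mulLeft ℂ x) (LinearMap.mulRight ℂ x)
    (fun a b => by simp [mul_assoc]) (fun a b => by simp [mul_assoc])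
    (fun a b => by simp [mul_assoc])
  map_smul' c x := ext (fun y => smul_mul_assoc c x y) (fun y => mul_smul_comm c y x)
  map_zero' := ext (fun y => zero_mul y) (fun y => mul_zero y)
  map_add' x y := ext (fun z => add_mul x y z) (fun z => mul_add z x y)
  map_mul' x y := ext (fun z => mul_assoc x y z) (fun z => (mul_assoc z x y).symm)

@[simp] lemma incl_lmul (x y : X) : (incl X x).lmul y = x * y := rfl
@[simp] lemma incl_rmul (x y : X) : (incl X x).rmul y = y * x := rfl

lemma incl_injective (hX : IsNondegenerate X) : Function.Injective (incl X) := by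
  intro x y h
  refine sub_eq_zero.1 (hX.eq_zero_of_mul_right _ fun b => ?_)
  have := congrArg (fun m : Mult X => m.lmul b) h
  simpa [sub_mul, sub_eq_zero] using this

lemma mul_incl (m : Mult X) (x : X) : m * incl X x = incl X (m.lmul x) := by
  ext y
  · simp [lmul_mul]
  · simp [mul_lmul]

lemma incl_mul (m : Mult X) (x : X) : incl X x * m = incl X (m.rmul x) := by
  ext y
  · simp [mul_lmul]
  · simp [rmul_mul]

variable {Y : Type*} [NonUnitalRing Y] [Module ℂ Y] [IsScalarTower ℂ Y Y] [SMulCommClass ℂ Y Y]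

/-- The multiplier `m ⊗ n` of `X ⊗ Y`. -/
def tmul (m : Mult X) (n : Mult Y) : Mult (X ⊗[ℂ] Y) :=
  mk (TensorProduct.map m.lmul n.lmul) (TensorProduct.map m.rmul n.rmul)
    (fun a b => by
      induction a using TensorProduct.induction_on with
      | zero => simp
      | add a a' h h' => simp [add_mul, h, h']
      | tmul x y =>
        induction b using TensorProduct.induction_on with
        | zero => simp
        | add b b' h h' => simp [mul_add, h, h']
        | tmul x' y' => simp [lmul_mul])
    (fun a b => by
      induction a using TensorProduct.induction_on with
      | zero => simp
      | add a a' h h' => simp [add_mul, h, h']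
      | tmul x y =>
        induction b using TensorProduct.induction_on with
        | zero => simp
        | add b b' h h' => simp [mul_add, h, h']
        | tmul x' y' => simp [rmul_mul])
    (fun a b => by
      induction a using TensorProduct.induction_on with
      | zero => simp
      | add a a' h h' => simp [add_mul, h, h']
      | tmul x y =>
        induction b using TensorProduct.induction_on with
        | zero => simp
        | add b b' h h' => simp [mul_add, h, h']
        | tmul x' y' => simp [mul_lmul])

@[simp] lemma tmul_lmul (m : Mult X) (n : Mult Y) :
    (tmul m n).lmul = TensorProduct.map m.lmul n.lmul := rfl
@[simp] lemma tmul_rmul (m : Mult X) (n : Mult Y) :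
    (tmul m n).rmul = TensorProduct.map m.rmul n.rmul := rfl

lemma ext_tensor {m n : Mult (X ⊗[ℂ] Y)} (hl : ∀ x y, m.lmul (x ⊗ₜ y) = n.lmul (x ⊗ₜ y))
    (hr : ∀ x y, m.rmul (x ⊗ₜ y) = n.rmul (x ⊗ₜ y)) : m = n := by
  have h1 : m.lmul = n.lmul := TensorProduct.ext' hl
  have h2 : m.rmul = n.rmul := TensorProduct.ext' hr
  exact ext (fun x => by rw [h1]) (fun x => by rw [h2])

lemma tmul_mul (m m' : Mult X) (n n' : Mult Y) :
    tmul m n * tmul m' n' = tmul (m * m') (n * n') := by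
  apply ext_tensor <;> intros <;> simp

lemma incl_tmul (x : X) (y : Y) : incl (X ⊗[ℂ] Y) (x ⊗ₜ[ℂ] y) = tmul (incl X x) (incl Y y) := by
  apply ext_tensor <;> intros <;> simp

/-- Transport of a multiplier along an isomorphism of algebras. -/
def congr (e : X ≃ₗ[ℂ] Y) (he : ∀ a b, e (a * b) = e a * e b) (m : Mult X) : Mult Y :=
  mk (e.conj m.lmul) (e.conj m.rmul)
    (fun a b => by
      obtain ⟨a, rfl⟩ := e.surjective a
      obtain ⟨b, rfl⟩ := e.surjective b
      simp [← he, LinearEquiv.conj_apply, lmul_mul])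
    (fun a b => by
      obtain ⟨a, rfl⟩ := e.surjective a
      obtain ⟨b, rfl⟩ := e.surjective b
      simp [← he, LinearEquiv.conj_apply, rmul_mul])
    (fun a b => by
      obtain ⟨a, rfl⟩ := e.surjective a
      obtain ⟨b, rfl⟩ := e.surjective b
      simp [← he, LinearEquiv.conj_apply, mul_lmul])

@[simp] lemma congr_lmul (e : X ≃ₗ[ℂ] Y) (he) (m : Mult X) (y : Y) :
    (congr e he m).lmul y = e (m.lmul (e.symm y)) := rfl
@[simp] lemma congr_rmul (e : X ≃ₗ[ℂ] Y) (he) (m : Mult X) (y : Y) :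
    (congr e he m).rmul y = e (m.rmul (e.symm y)) := rfl

/-- Transport of homomorphisms into multiplier algebras along an isomorphism of algebras. -/
def congrHom {Z : Type*} [NonUnitalRing Z] [Module ℂ Z] (e : X ≃ₗ[ℂ] Y)
    (he : ∀ a b, e (a * b) = e a * e b) (π : Z →ₙₐ[ℂ] Mult X) : Z →ₙₐ[ℂ] Mult Y where
  toFun z := congr e he (π z)
  map_smul' c x := by ext y <;> simp
  map_zero' := by ext y <;> simp
  map_add' x y := by ext z <;> simp
  map_mul' x y := by ext z <;> simp

@[simp] lemma congrHom_apply {Z : Type*} [NonUnitalRing Z] [Module ℂ Z] (e : X ≃ₗ[ℂ] Y) (he)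
    (π : Z →ₙₐ[ℂ] Mult X) (z : Z) : congrHom e he π z = congr e he (π z) := rfl

end Mult

variable {Y : Type*} [NonUnitalRing Y] [Module ℂ Y] [IsScalarTower ℂ Y Y] [SMulCommClass ℂ Y Y]

/-- A homomorphism `π : X → M(Y)` is non-degenerate if `π(X) Y = Y = Y π(X)` (linear spans). -/
structure IsNondegenerateHom (π : X →ₙₐ[ℂ] Mult Y) : Prop where
  span_lmul : Submodule.span ℂ {z : Y | ∃ x y, z = (π x).lmul y} = ⊤
  span_rmul : Submodule.span ℂ {z : Y | ∃ x y, z = (π x).rmul y} = ⊤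

/-- The multiplier `n` of `Y` is the value at `m ∈ M(X)` of the extension of `π : X → M(Y)`. -/
def IsExtensionAt (π : X →ₙₐ[ℂ] Mult Y) (m : Mult X) (n : Mult Y) : Prop :=
  ∀ x, n * π x = π (m.lmul x) ∧ π x * n = π (m.rmul x)

open Classical in
/-- The extension `M(X) → M(Y)` of a non-degenerate homomorphism `π : X → M(Y)`, into a
non-degenerate algebra: its value at `m` is the unique `n` with `n π(x) = π(m x)` and
`π(x) n = π(x m)` for all `x`. -/
noncomputable def extend (π : X →ₙₐ[ℂ] Mult Y) (m : Mult X) : Mult Y :=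
  if h : ∃ n, IsExtensionAt π m n then h.choose else 0

/-- Left multiplication is determined on the range of a non-degenerate homomorphism. -/
lemma IsNondegenerateHom.ext (hY : IsNondegenerate Y) {π : X →ₙₐ[ℂ] Mult Y}
    (hπ : IsNondegenerateHom π) {n n' : Mult Y} (h : ∀ x, n * π x = n' * π x) : n = n' := by
  apply Mult.ext_left hY
  suffices n.lmul = n'.lmul by intro x; rw [this]
  apply LinearMap.ext_on hπ.span_lmul
  rintro z ⟨x, y, rfl⟩
  exact congrArg (fun m : Mult Y => m.lmul y) (h x)

private lemma exists_factor {V W Z : Type*} [AddCommGroup V] [Module ℂ V] [AddCommGroup W]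
    [Module ℂ W] [AddCommGroup Z] [Module ℂ Z] (f : V →ₗ[ℂ] W) (g : V →ₗ[ℂ] Z)
    (hf : LinearMap.range f = ⊤) (h : ∀ v, f v = 0 → g v = 0) :
    ∃ k : W →ₗ[ℂ] Z, ∀ v, k (f v) = g v := by
  obtain ⟨s, hs⟩ := f.exists_rightInverse_of_surjective hf
  refine ⟨g ∘ₗ s, fun v => ?_⟩
  have : f (s (f v) - v) = 0 := by
    rw [map_sub, sub_eq_zero]; exact LinearMap.congr_fun hs (f v)
  have := h _ this
  rwa [map_sub, sub_eq_zero] at this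

/-- The extension of a non-degenerate homomorphism exists. -/
lemma exists_isExtensionAt (hY : IsNondegenerate Y) {π : X →ₙₐ[ℂ] Mult Y}
    (hπ : IsNondegenerateHom π) (m : Mult X) : ∃ n, IsExtensionAt π m n := by
  let lin (f : X →ₗ[ℂ] X) : X ⊗[ℂ] Y →ₗ[ℂ] Y :=
    TensorProduct.lift (LinearMap.mk₂ ℂ (fun x y => (π (f x)).lmul y)
      (by intros; simp) (by intros; simp) (by intros; simp) (by intros; simp))
  let rin (f : X →ₗ[ℂ] X) : X ⊗[ℂ] Y →ₗ[ℂ] Y :=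
    TensorProduct.lift (LinearMap.mk₂ ℂ (fun x y => (π (f x)).rmul y)
      (by intros; simp) (by intros; simp) (by intros; simp) (by intros; simp))
  have hlin : ∀ f x y, lin f (x ⊗ₜ y) = (π (f x)).lmul y := fun f x y => rfl
  have hrin : ∀ f x y, rin f (x ⊗ₜ y) = (π (f x)).rmul y := fun f x y => rfl
  have hl : LinearMap.range (lin LinearMap.id) = ⊤ := by
    rw [← top_le_iff, ← hπ.span_lmul, Submodule.span_le]
    rintro z ⟨x, y, rfl⟩
    exact ⟨x ⊗ₜ y, rfl⟩
  have hr : LinearMap.range (rin LinearMap.id) = ⊤ := by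
    rw [← top_le_iff, ← hπ.span_rmul, Submodule.span_le]
    rintro z ⟨x, y, rfl⟩
    exact ⟨x ⊗ₜ y, rfl⟩
  have key : ∀ u v, rin m.rmul u * lin LinearMap.id v = rin LinearMap.id u * lin m.lmul v := by
    intro u v
    induction u using TensorProduct.induction_on with
    | zero => simp
    | add a a' h h' => simp [add_mul, h, h']
    | tmul x y =>
      induction v using TensorProduct.induction_on with
      | zero => simp
      | add b b' h h' => simp [mul_add, h, h']
      | tmul x' y' =>
        simp only [hlin, hrin, ← Mult.mul_lmul, LinearMap.id_apply]
        rw [← Mult.mul_lmul_apply, ← Mult.mul_lmul_apply, ← map_mul, ← map_mul, ← Mult.mul_lmul,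
          Mult.mul_lmul m]
  obtain ⟨L, hL⟩ := exists_factor (lin LinearMap.id) (lin m.lmul) hl (fun v hv => by
    apply hY.eq_zero_of_mul_left
    intro b
    obtain ⟨u, rfl⟩ : b ∈ LinearMap.range (rin LinearMap.id) := hr ▸ Submodule.mem_top
    rw [← key, hv, mul_zero])
  obtain ⟨R, hR⟩ := exists_factor (rin LinearMap.id) (rin m.rmul) hr (fun v hv => by
    apply hY.eq_zero_of_mul_right
    intro b
    obtain ⟨u, rfl⟩ : b ∈ LinearMap.range (lin LinearMap.id) := hl ▸ Submodule.mem_top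
    rw [key, hv, zero_mul])
  have hLR : ∀ a b, a * L b = R a * b := by
    intro a b
    obtain ⟨u, rfl⟩ : a ∈ LinearMap.range (rin LinearMap.id) := hr ▸ Submodule.mem_top
    obtain ⟨v, rfl⟩ : b ∈ LinearMap.range (lin LinearMap.id) := hl ▸ Submodule.mem_top
    rw [hL, hR, key]
  have hLm : ∀ a b, L (a * b) = L a * b := fun a b => by
    refine sub_eq_zero.1 (hY.eq_zero_of_mul_left _ fun c => ?_)
    rw [mul_sub, hLR, ← mul_assoc, ← mul_assoc, hLR, sub_self]
  have hRm : ∀ a b, R (a * b) = a * R b := fun a b => by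
    refine sub_eq_zero.1 (hY.eq_zero_of_mul_right _ fun c => ?_)
    rw [sub_mul, ← hLR, mul_assoc, mul_assoc, hLR, sub_self]
  refine ⟨Mult.mk L R hLm hRm hLR, fun x => ⟨?_, ?_⟩⟩
  · exact Mult.ext_left hY fun y => hL (x ⊗ₜ y)
  · refine Mult.ext_left hY fun y => sub_eq_zero.1 (hY.eq_zero_of_mul_left _ fun c => ?_)
    rw [mul_sub, Mult.mul_lmul, Mult.mul_lmul, Mult.mul_rmul_apply, Mult.rmul_mk, sub_eq_zero]
    exact congrArg (· * y) (hR (x ⊗ₜ c))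

lemma extend_spec (hY : IsNondegenerate Y) {π : X →ₙₐ[ℂ] Mult Y} (hπ : IsNondegenerateHom π)
    (m : Mult X) : IsExtensionAt π m (extend π m) := by
  have h := exists_isExtensionAt hY hπ m
  rw [extend, dif_pos h]
  exact h.choose_spec

lemma extend_eq (hY : IsNondegenerate Y) {π : X →ₙₐ[ℂ] Mult Y} (hπ : IsNondegenerateHom π)
    {m : Mult X} {n : Mult Y} (h : IsExtensionAt π m n) : extend π m = n :=
  hπ.ext hY fun x => by rw [(extend_spec hY hπ m x).1, (h x).1]

variable {X' Y' : Type*} [NonUnitalRing X'] [Module ℂ X'] [IsScalarTower ℂ X' X']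
  [SMulCommClass ℂ X' X'] [NonUnitalRing Y'] [Module ℂ Y'] [IsScalarTower ℂ Y' Y']
  [SMulCommClass ℂ Y' Y']

/-- The homomorphism `π ⊗ ρ : X ⊗ X' → M(Y ⊗ Y')`, `x ⊗ x' ↦ π(x) ⊗ ρ(x')`. -/
def homTensor (π : X →ₙₐ[ℂ] Mult Y) (ρ : X' →ₙₐ[ℂ] Mult Y') :
    X ⊗[ℂ] X' →ₙₐ[ℂ] Mult (Y ⊗[ℂ] Y') :=
  let f : X ⊗[ℂ] X' →ₗ[ℂ] Mult (Y ⊗[ℂ] Y') :=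
    TensorProduct.lift (LinearMap.mk₂ ℂ (fun x x' => Mult.tmul (π x) (ρ x'))
      (by intros; apply Mult.ext_tensor <;> intros <;> simp [TensorProduct.add_tmul])
      (by intros; apply Mult.ext_tensor <;> intros <;> simp [TensorProduct.smul_tmul'])
      (by intros; apply Mult.ext_tensor <;> intros <;> simp [TensorProduct.tmul_add])
      (by intros; apply Mult.ext_tensor <;> intros <;> simp))
  { toFun := f
    map_smul' := f.map_smul
    map_zero' := f.map_zero
    map_add' := f.map_add
    map_mul' := fun a b => by
      induction a using TensorProduct.induction_on with
      | zero => simp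
      | add a a' h h' => simp [add_mul, h, h']
      | tmul x y =>
        induction b using TensorProduct.induction_on with
        | zero => simp
        | add b b' h h' => simp [mul_add, h, h']
        | tmul x' y' => simp [f, Mult.tmul_mul] }

@[simp] lemma homTensor_tmul (π : X →ₙₐ[ℂ] Mult Y) (ρ : X' →ₙₐ[ℂ] Mult Y') (x : X) (x' : X') :
    homTensor π ρ (x ⊗ₜ x') = Mult.tmul (π x) (ρ x') := rfl

end Multiplier

/-! ### Leg-numbering, slicing -/

section Legs

variable {X Y Z : Type*}
  [NonUnitalRing X] [Module ℂ X] [IsScalarTower ℂ X X] [SMulCommClass ℂ X X]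
  [NonUnitalRing Y] [Module ℂ Y] [IsScalarTower ℂ Y Y] [SMulCommClass ℂ Y Y]
  [NonUnitalRing Z] [Module ℂ Z] [IsScalarTower ℂ Z Z] [SMulCommClass ℂ Z Z]

lemma assoc_mul (a b : (X ⊗[ℂ] Y) ⊗[ℂ] Z) : TensorProduct.assoc ℂ X Y Z (a * b) =
    TensorProduct.assoc ℂ X Y Z a * TensorProduct.assoc ℂ X Y Z b := by
  induction a using TensorProduct.induction_on with
  | zero => simp
  | add a a' h h' => simp [add_mul, h, h']
  | tmul x z =>
    induction b using TensorProduct.induction_on with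
    | zero => simp
    | add b b' h h' => simp [mul_add, h, h']
    | tmul x' z' =>
      induction x using TensorProduct.induction_on with
      | zero => simp
      | add a a' h h' => simp [add_mul, TensorProduct.add_tmul] at h h' ⊢; rw [h, h']
      | tmul x y =>
        induction x' using TensorProduct.induction_on with
        | zero => simp
        | add a a' h h' => simp [mul_add, TensorProduct.add_tmul] at h h' ⊢; rw [h, h']
        | tmul x' y' => simp

lemma leftComm_mul (a b : X ⊗[ℂ] (Y ⊗[ℂ] Z)) : TensorProduct.leftComm ℂ X Y Z (a * b) =
    TensorProduct.leftComm ℂ X Y Z a * TensorProduct.leftComm ℂ X Y Z b := by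
  induction a using TensorProduct.induction_on with
  | zero => simp
  | add a a' h h' => simp [add_mul, h, h']
  | tmul z x =>
    induction b using TensorProduct.induction_on with
    | zero => simp
    | add b b' h h' => simp [mul_add, h, h']
    | tmul z' x' =>
      induction x using TensorProduct.induction_on with
      | zero => simp
      | add a a' h h' => simp [add_mul, TensorProduct.tmul_add] at h h' ⊢; rw [h, h']
      | tmul x y =>
        induction x' using TensorProduct.induction_on with
        | zero => simp
        | add a a' h h' => simp [mul_add, TensorProduct.tmul_add] at h h' ⊢; rw [h, h']
        | tmul x' y' => simp

/-- For `V ∈ M(X ⊗ Y)`, the element `V₂₃ = 1 ⊗ V` of `M(X ⊗ X ⊗ Y)`. -/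
def leg₂₃ (V : Mult (X ⊗[ℂ] Y)) : Mult (X ⊗[ℂ] (X ⊗[ℂ] Y)) := Mult.tmul 1 V

/-- For `V ∈ M(X ⊗ Y)`, the element `V₁₃` of `M(X ⊗ X ⊗ Y)`, obtained from `1 ⊗ V` by flipping
the first two legs. -/
def leg₁₃ (V : Mult (X ⊗[ℂ] Y)) : Mult (X ⊗[ℂ] (X ⊗[ℂ] Y)) :=
  Mult.congr (TensorProduct.leftComm ℂ X X Y) leftComm_mul (Mult.tmul 1 V)

variable (Y) in
/-- For `Δ : X → M(X ⊗ X)`, the homomorphism `Δ ⊗ ι : X ⊗ Y → M(X ⊗ X ⊗ Y)`. -/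
def comulTensorId (Δ : X →ₙₐ[ℂ] Mult (X ⊗[ℂ] X)) : X ⊗[ℂ] Y →ₙₐ[ℂ] Mult (X ⊗[ℂ] (X ⊗[ℂ] Y)) :=
  Mult.congrHom (TensorProduct.assoc ℂ X X Y) assoc_mul (homTensor Δ (Mult.incl Y))

/-- For `Δ : X → M(X ⊗ X)`, the homomorphism `ι ⊗ Δ : X ⊗ X → M(X ⊗ X ⊗ X)`. -/
def idTensorComul (Δ : X →ₙₐ[ℂ] Mult (X ⊗[ℂ] X)) : X ⊗[ℂ] X →ₙₐ[ℂ] Mult (X ⊗[ℂ] (X ⊗[ℂ] X)) :=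
  homTensor (Mult.incl X) Δ

/-- The slice map `ω ⊗ ι : X ⊗ Y → Y`, `x ⊗ y ↦ ω(x) y`. -/
def sliceFst (ω : Module.Dual ℂ X) : X ⊗[ℂ] Y →ₗ[ℂ] Y :=
  (TensorProduct.lid ℂ Y).toLinearMap ∘ₗ TensorProduct.map ω LinearMap.id

/-- The slice map `ι ⊗ ω : X ⊗ Y → X`, `x ⊗ y ↦ ω(y) x`. -/
def sliceSnd (ω : Module.Dual ℂ Y) : X ⊗[ℂ] Y →ₗ[ℂ] X :=
  (TensorProduct.rid ℂ X).toLinearMap ∘ₗ TensorProduct.map LinearMap.id ω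

@[simp] lemma sliceFst_tmul (ω : Module.Dual ℂ X) (x : X) (y : Y) :
    sliceFst ω (x ⊗ₜ[ℂ] y) = ω x • y := by simp [sliceFst]

@[simp] lemma sliceSnd_tmul (ω : Module.Dual ℂ Y) (x : X) (y : Y) :
    sliceSnd ω (x ⊗ₜ[ℂ] y) = ω y • x := by simp [sliceSnd]

variable (X) in
/-- The functional `a ω : x ↦ ω(x a)`, bilinear in `a` and `ω`. -/
def actFunctional : X →ₗ[ℂ] Module.Dual ℂ X →ₗ[ℂ] Module.Dual ℂ X :=
  LinearMap.mk₂ ℂ (fun a ω => ω ∘ₗ LinearMap.mulRight ℂ a)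
    (fun a b ω => by ext x; simp [mul_add]) (fun c a ω => by ext x; simp [mul_smul_comm])
    (fun a ω ω' => by ext x; simp) (fun c a ω => by ext x; simp)

@[simp] lemma actFunctional_apply (a : X) (ω : Module.Dual ℂ X) (x : X) :
    actFunctional X a ω x = ω (x * a) := rfl

end Legs

/-! ### Algebraic quantum groups -/

section QuantumGroup

variable (A : Type*) [NonUnitalRing A] [Module ℂ A] [IsScalarTower ℂ A A] [SMulCommClass ℂ A A]

/-- A regular multiplier Hopf algebra: a non-degenerate algebra `A` with a non-degenerate
homomorphism `Δ : A → M(A ⊗ A)` that is coassociative and for which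
`a ⊗ b ↦ Δ(a)(b ⊗ 1)`, `a ⊗ b ↦ Δ(a)(1 ⊗ b)`, `a ⊗ b ↦ (b ⊗ 1)Δ(a)`, `a ⊗ b ↦ (1 ⊗ b)Δ(a)`
are bijections of `A ⊗ A` onto `A ⊗ A ⊆ M(A ⊗ A)`. These bijections (which are determined by `Δ`)
are recorded as `T₁`, `T₂`, `T₃`, `T₄`. -/
structure RegularMultiplierHopfAlgebra where
  nondegenerate : IsNondegenerate A
  comul : A →ₙₐ[ℂ] Mult (A ⊗[ℂ] A)
  comul_nondegenerate : IsNondegenerateHom comul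
  coassoc : ∀ a, extend (comulTensorId A comul) (comul a) = extend (idTensorComul comul) (comul a)
  T₁ : A ⊗[ℂ] A ≃ₗ[ℂ] A ⊗[ℂ] A
  T₂ : A ⊗[ℂ] A ≃ₗ[ℂ] A ⊗[ℂ] A
  T₃ : A ⊗[ℂ] A ≃ₗ[ℂ] A ⊗[ℂ] A
  T₄ : A ⊗[ℂ] A ≃ₗ[ℂ] A ⊗[ℂ] A
  incl_T₁ : ∀ a b, Mult.incl (A ⊗[ℂ] A) (T₁ (a ⊗ₜ b)) = comul a * Mult.tmul (Mult.incl A b) 1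
  incl_T₂ : ∀ a b, Mult.incl (A ⊗[ℂ] A) (T₂ (a ⊗ₜ b)) = comul a * Mult.tmul 1 (Mult.incl A b)
  incl_T₃ : ∀ a b, Mult.incl (A ⊗[ℂ] A) (T₃ (a ⊗ₜ b)) = Mult.tmul (Mult.incl A b) 1 * comul a
  incl_T₄ : ∀ a b, Mult.incl (A ⊗[ℂ] A) (T₄ (a ⊗ₜ b)) = Mult.tmul 1 (Mult.incl A b) * comul a

variable {A} in
/-- A functional `ω` is left invariant if `(ι ⊗ ω)Δ(a) = ω(a) 1` for all `a`, where
`(ι ⊗ ω)Δ(a)` is the multiplier `m` of `A` with `m b = (ι ⊗ ω)(Δ(a)(b ⊗ 1))` and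
`b m = (ι ⊗ ω)((b ⊗ 1)Δ(a))` for all `b`. -/
def RegularMultiplierHopfAlgebra.IsLeftInvariant (H : RegularMultiplierHopfAlgebra A)
    (ω : Module.Dual ℂ A) : Prop :=
  ∀ a b, sliceSnd ω (H.T₁ (a ⊗ₜ b)) = ω a • b ∧ sliceSnd ω (H.T₃ (a ⊗ₜ b)) = ω a • b

/-- An algebraic quantum group: a regular multiplier Hopf algebra together with a (fixed)
non-zero left invariant functional, its left Haar functional. -/
structure AlgebraicQuantumGroup extends RegularMultiplierHopfAlgebra A where
  haar : Module.Dual ℂ A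
  haar_ne_zero : haar ≠ 0
  haar_leftInvariant : toRegularMultiplierHopfAlgebra.IsLeftInvariant haar

end QuantumGroup

/-! ### The dual algebra -/

section Dual

open Mult

section Aux

variable {X Y Z : Type*}
  [NonUnitalRing X] [Module ℂ X] [IsScalarTower ℂ X X] [SMulCommClass ℂ X X]
  [NonUnitalRing Y] [Module ℂ Y] [IsScalarTower ℂ Y Y] [SMulCommClass ℂ Y Y]
  [NonUnitalRing Z] [Module ℂ Z] [IsScalarTower ℂ Z Z] [SMulCommClass ℂ Z Z]

lemma eq_zero_of_sliceSnd {t : X ⊗[ℂ] Y} (h : ∀ ω : Module.Dual ℂ Y, sliceSnd ω t = 0) :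
    t = 0 := by
  classical
  let b := Module.Basis.ofVectorSpace ℂ Y
  apply (TensorProduct.equivFinsuppOfBasisRight (M := X) b).injective
  rw [map_zero]
  ext i
  rw [Finsupp.zero_apply, ← h (b.coord i)]
  clear h
  induction t using TensorProduct.induction_on with
  | zero => simp
  | add t t' h h' => simp [h, h']
  | tmul x y => simp

lemma eq_zero_of_sliceFst {t : X ⊗[ℂ] Y} (h : ∀ ω : Module.Dual ℂ X, sliceFst ω t = 0) :
    t = 0 := by
  apply (TensorProduct.comm ℂ X Y).injective
  rw [map_zero]
  apply eq_zero_of_sliceSnd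
  intro ω
  rw [← h ω]
  clear h
  induction t using TensorProduct.induction_on with
  | zero => simp
  | add t t' h h' => simp [h, h']
  | tmul x y => simp

/-- The tensor product of non-degenerate algebras is non-degenerate. -/
lemma IsNondegenerate.tensor (hX : IsNondegenerate X) (hY : IsNondegenerate Y) :
    IsNondegenerate (X ⊗[ℂ] Y) := by
  constructor
  · intro t ht
    apply eq_zero_of_sliceSnd
    intro ω
    apply hX.eq_zero_of_mul_right
    intro x
    have h1 : TensorProduct.map (LinearMap.mulRight ℂ x) LinearMap.id t = 0 := by
      apply eq_zero_of_sliceFst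
      intro η
      apply hY.eq_zero_of_mul_right
      intro y
      have := congrArg (sliceFst η) (ht (x ⊗ₜ y))
      rw [map_zero] at this
      rw [← this]
      clear this ht
      induction t using TensorProduct.induction_on with
      | zero => simp
      | add t t' h h' => simp [add_mul, h, h']
      | tmul x y => simp [smul_mul_assoc]
    have := congrArg (sliceSnd ω) h1
    rw [map_zero] at this
    rw [← this]
    clear this h1 ht
    induction t using TensorProduct.induction_on with
    | zero => simp
    | add t t' h h' => simp [add_mul, h, h']
    | tmul x y => simp [smul_mul_assoc]
  · intro t ht
    apply eq_zero_of_sliceSnd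
    intro ω
    apply hX.eq_zero_of_mul_left
    intro x
    have h1 : TensorProduct.map (LinearMap.mulLeft ℂ x) LinearMap.id t = 0 := by
      apply eq_zero_of_sliceFst
      intro η
      apply hY.eq_zero_of_mul_left
      intro y
      have := congrArg (sliceFst η) (ht (x ⊗ₜ y))
      rw [map_zero] at this
      rw [← this]
      clear this ht
      induction t using TensorProduct.induction_on with
      | zero => simp
      | add t t' h h' => simp [mul_add, h, h']
      | tmul x y => simp [mul_smul_comm]
    have := congrArg (sliceSnd ω) h1
    rw [map_zero] at this
    rw [← this]
    clear this h1 ht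
    induction t using TensorProduct.induction_on with
    | zero => simp
    | add t t' h h' => simp [mul_add, h, h']
    | tmul x y => simp [mul_smul_comm]

private lemma span_tensor {s : Set X} {t : Set Y} (hs : Submodule.span ℂ s = ⊤)
    (ht : Submodule.span ℂ t = ⊤) {P : Submodule ℂ (X ⊗[ℂ] Y)}
    (h : ∀ x ∈ s, ∀ y ∈ t, x ⊗ₜ[ℂ] y ∈ P) : P = ⊤ := by
  rw [← top_le_iff, ← TensorProduct.map₂_mk_top_top_eq_top, ← hs, ← ht,
    Submodule.map₂_span_span, Submodule.span_le]
  rintro _ ⟨x, hx, y, hy, rfl⟩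
  exact h x hx y hy

variable {X' Y' : Type*} [NonUnitalRing X'] [Module ℂ X'] [IsScalarTower ℂ X' X']
  [SMulCommClass ℂ X' X'] [NonUnitalRing Y'] [Module ℂ Y'] [IsScalarTower ℂ Y' Y']
  [SMulCommClass ℂ Y' Y']

lemma IsNondegenerateHom.tensor {π : X →ₙₐ[ℂ] Mult Y} {ρ : X' →ₙₐ[ℂ] Mult Y'}
    (hπ : IsNondegenerateHom π) (hρ : IsNondegenerateHom ρ) :
    IsNondegenerateHom (homTensor π ρ) := by
  constructor
  · refine span_tensor hπ.span_lmul hρ.span_lmul ?_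
    rintro _ ⟨x, y, rfl⟩ _ ⟨x', y', rfl⟩
    exact Submodule.subset_span ⟨x ⊗ₜ x', y ⊗ₜ y', by simp⟩
  · refine span_tensor hπ.span_rmul hρ.span_rmul ?_
    rintro _ ⟨x, y, rfl⟩ _ ⟨x', y', rfl⟩
    exact Submodule.subset_span ⟨x ⊗ₜ x', y ⊗ₜ y', by simp⟩

lemma IsNondegenerateHom.congrHom {π : Z →ₙₐ[ℂ] Mult X} (hπ : IsNondegenerateHom π)
    (e : X ≃ₗ[ℂ] Y) (he : ∀ a b, e (a * b) = e a * e b) :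
    IsNondegenerateHom (congrHom e he π) := by
  constructor
  · have := congrArg (Submodule.map e.toLinearMap) hπ.span_lmul
    rw [Submodule.map_span, Submodule.map_top, LinearEquiv.range] at this
    rw [← top_le_iff, ← this]
    apply Submodule.span_mono
    rintro _ ⟨_, ⟨x, y, rfl⟩, rfl⟩
    exact ⟨x, e y, by simp⟩
  · have := congrArg (Submodule.map e.toLinearMap) hπ.span_rmul
    rw [Submodule.map_span, Submodule.map_top, LinearEquiv.range] at this
    rw [← top_le_iff, ← this]
    apply Submodule.span_mono
    rintro _ ⟨_, ⟨x, y, rfl⟩, rfl⟩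
    exact ⟨x, e y, by simp⟩

end Aux

namespace AlgebraicQuantumGroup

variable {A : Type*} [NonUnitalRing A] [Module ℂ A] [IsScalarTower ℂ A A] [SMulCommClass ℂ A A]

lemma nondegenerate₂ (H : AlgebraicQuantumGroup A) : IsNondegenerate (A ⊗[ℂ] A) := H.nondegenerate.tensor H.nondegenerate

lemma nondegenerate₃ (H : AlgebraicQuantumGroup A) : IsNondegenerate (A ⊗[ℂ] (A ⊗[ℂ] A)) :=
  H.nondegenerate.tensor H.nondegenerate₂

lemma comul_lmul_tmul (H : AlgebraicQuantumGroup A) (x b c : A) : (H.comul x).lmul (b ⊗ₜ c) =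
    TensorProduct.map LinearMap.id (LinearMap.mulRight ℂ c) (H.T₁ (x ⊗ₜ b)) := by
  apply incl_injective H.nondegenerate₂
  have h : TensorProduct.map LinearMap.id (LinearMap.mulRight ℂ c) (H.T₁ (x ⊗ₜ b)) =
    (tmul 1 (incl A c)).rmul (H.T₁ (x ⊗ₜ b)) := rfl
  rw [h, ← mul_incl, ← incl_mul, H.incl_T₁, incl_tmul, mul_assoc, tmul_mul, mul_one, one_mul]

lemma span_mul_eq_top (H : AlgebraicQuantumGroup A) : Submodule.span ℂ {z : A | ∃ x y, z = x * y} = ⊤ := by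
  obtain ⟨d, hd⟩ : ∃ d, H.haar d = 1 := by
    obtain ⟨d, hd⟩ : ∃ d, H.haar d ≠ 0 := by
      by_contra! h
      exact H.haar_ne_zero (LinearMap.ext h)
    exact ⟨(H.haar d)⁻¹ • d, by simp [hd]⟩
  rw [← top_le_iff]
  intro a _
  have key : ∀ u : A ⊗[ℂ] A, ∀ c, sliceFst H.haar
      (TensorProduct.map LinearMap.id (LinearMap.mulRight ℂ c) u) ∈
      Submodule.span ℂ {z : A | ∃ x y, z = x * y} := by
    intro u c
    induction u using TensorProduct.induction_on with
    | zero => simp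
    | add t t' h h' => rw [map_add, map_add]; exact add_mem h h'
    | tmul x y =>
      simp only [TensorProduct.map_tmul, sliceFst_tmul]
      exact Submodule.smul_mem _ _ (Submodule.subset_span ⟨_, _, rfl⟩)
  have key2 : ∀ v : A ⊗[ℂ] A, ∀ x, sliceFst H.haar ((H.comul x).lmul v) ∈
      Submodule.span ℂ {z : A | ∃ x y, z = x * y} := by
    intro v x
    induction v using TensorProduct.induction_on with
    | zero => simp
    | add t t' h h' => rw [map_add, map_add]; exact add_mem h h'
    | tmul b c => rw [comul_lmul_tmul]; exact key _ _
  have h2 : d ⊗ₜ[ℂ] a ∈ Submodule.span ℂ {z | ∃ x y, z = (H.comul x).lmul y} := by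
    rw [H.comul_nondegenerate.span_lmul]; trivial
  have h3 := Submodule.mem_map_of_mem (f := sliceFst H.haar) h2
  rw [Submodule.map_span] at h3
  rw [sliceFst_tmul, hd, one_smul] at h3
  refine Submodule.span_le.2 ?_ h3
  rintro _ ⟨_, ⟨x, y, rfl⟩, rfl⟩
  exact key2 y x

lemma isNondegenerateHom_incl (H : AlgebraicQuantumGroup A) : IsNondegenerateHom (incl A) := by
  refine ⟨H.span_mul_eq_top, ?_⟩
  rw [← H.span_mul_eq_top]
  congr 1
  ext z
  exact exists_comm

lemma isNondegenerateHom_comulTensorId (H : AlgebraicQuantumGroup A) : IsNondegenerateHom (comulTensorId A H.comul) :=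
  (H.comul_nondegenerate.tensor H.isNondegenerateHom_incl).congrHom _ _

lemma isNondegenerateHom_idTensorComul (H : AlgebraicQuantumGroup A) : IsNondegenerateHom (idTensorComul H.comul) :=
  H.isNondegenerateHom_incl.tensor H.comul_nondegenerate

end AlgebraicQuantumGroup

section Aux

variable {X Y : Type*}
  [NonUnitalRing X] [Module ℂ X] [IsScalarTower ℂ X X] [SMulCommClass ℂ X X]
  [NonUnitalRing Y] [Module ℂ Y] [IsScalarTower ℂ Y Y] [SMulCommClass ℂ Y Y]

private lemma congr_mul (e : X ≃ₗ[ℂ] Y) (he : ∀ a b, e (a * b) = e a * e b) (m n : Mult X) :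
    Mult.congr e he (m * n) = Mult.congr e he m * Mult.congr e he n := by
  ext y <;> simp

private lemma incl_congr (e : X ≃ₗ[ℂ] Y) (he : ∀ a b, e (a * b) = e a * e b) (x : X) :
    incl Y (e x) = Mult.congr e he (incl X x) := by
  ext y
  · simp [he]
  · simp [he]

variable (X Y) in
private def assocMult (m : Mult ((X ⊗[ℂ] X) ⊗[ℂ] Y)) : Mult (X ⊗[ℂ] (X ⊗[ℂ] Y)) :=
  Mult.congr (TensorProduct.assoc ℂ X X Y) (assoc_mul (X := X) (Y := X) (Z := Y)) m

private lemma assocMult_mul (m n : Mult ((X ⊗[ℂ] X) ⊗[ℂ] Y)) :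
    assocMult X Y (m * n) = assocMult X Y m * assocMult X Y n :=
  congr_mul _ _ m n

private lemma tmul_one_eq (m : Mult X) :
    Mult.tmul m (1 : Mult (X ⊗[ℂ] Y)) = assocMult X Y (Mult.tmul (Mult.tmul m 1) 1) := by
  have hl : (Mult.tmul m (1 : Mult (X ⊗[ℂ] Y))).lmul =
      (assocMult X Y (Mult.tmul (Mult.tmul m 1) 1)).lmul :=
    TensorProduct.ext_threefold' (fun x y z => by simp [assocMult])
  have hr : (Mult.tmul m (1 : Mult (X ⊗[ℂ] Y))).rmul =
      (assocMult X Y (Mult.tmul (Mult.tmul m 1) 1)).rmul :=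
    TensorProduct.ext_threefold' (fun x y z => by simp [assocMult])
  exact Mult.ext (fun x => by rw [hl]) (fun x => by rw [hr])

private lemma one_tmul_eq (m : Mult Y) :
    Mult.tmul (1 : Mult X) (Mult.tmul (1 : Mult X) m) = assocMult X Y (Mult.tmul 1 m) := by
  have hl : (Mult.tmul (1 : Mult X) (Mult.tmul (1 : Mult X) m)).lmul =
      (assocMult X Y (Mult.tmul 1 m)).lmul :=
    TensorProduct.ext_threefold' (fun x y z => by simp [assocMult])
  have hr : (Mult.tmul (1 : Mult X) (Mult.tmul (1 : Mult X) m)).rmul =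
      (assocMult X Y (Mult.tmul 1 m)).rmul :=
    TensorProduct.ext_threefold' (fun x y z => by simp [assocMult])
  exact Mult.ext (fun x => by rw [hl]) (fun x => by rw [hr])

variable (Δ : X →ₙₐ[ℂ] Mult (X ⊗[ℂ] X))

private lemma comulTensorId_tmul (p : X) (q : Y) : comulTensorId Y Δ (p ⊗ₜ q) =
    assocMult X Y (Mult.tmul (Δ p) (incl Y q)) := rfl

private lemma idTensorComul_tmul (p q : X) : idTensorComul Δ (p ⊗ₜ q) =
    tmul (incl X p) (Δ q) := rfl

private lemma one_tmul_mul_comulTensorId (y : Y) (u : X ⊗[ℂ] Y) :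
    tmul 1 (tmul 1 (incl Y y)) * comulTensorId Y Δ u =
      comulTensorId Y Δ ((tmul 1 (incl Y y)).lmul u) := by
  induction u using TensorProduct.induction_on with
  | zero => rw [map_zero, map_zero, map_zero, mul_zero]
  | add t t' h h' => rw [map_add, map_add, map_add, mul_add, h, h']
  | tmul p q =>
    rw [one_tmul_eq, comulTensorId_tmul, ← assocMult_mul, tmul_mul, one_mul, ← map_mul]
    rfl

private lemma tmul_one_mul_idTensorComul (x : X) (u : X ⊗[ℂ] X) :
    tmul (incl X x) 1 * idTensorComul Δ u = idTensorComul Δ ((tmul (incl X x) 1).lmul u) := by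
  induction u using TensorProduct.induction_on with
  | zero => rw [map_zero, map_zero, map_zero, mul_zero]
  | add t t' h h' => rw [map_add, map_add, map_add, mul_add, h, h']
  | tmul p q =>
    rw [idTensorComul_tmul, tmul_mul, one_mul, ← map_mul]
    rfl

end Aux

namespace AlgebraicQuantumGroup

variable {A : Type*} [NonUnitalRing A] [Module ℂ A] [IsScalarTower ℂ A A] [SMulCommClass ℂ A A]

private lemma incl_T₁_tensor (H : AlgebraicQuantumGroup A) (b : A) (u : A ⊗[ℂ] A) :
    incl (A ⊗[ℂ] (A ⊗[ℂ] A)) (TensorProduct.assoc ℂ A A A (TensorProduct.map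
      (H.T₁.toLinearMap ∘ₗ (TensorProduct.mk ℂ A A).flip b) LinearMap.id u)) =
      comulTensorId A H.comul u * tmul (incl A b) 1 := by
  induction u using TensorProduct.induction_on with
  | zero => rw [map_zero, map_zero, map_zero, map_zero, zero_mul]
  | add t t' h h' => rw [map_add, map_add, map_add, h, h', map_add, add_mul]
  | tmul p q =>
    rw [comulTensorId_tmul, tmul_one_eq, ← assocMult_mul, tmul_mul, ← H.incl_T₁, mul_one, ← incl_tmul]
    exact incl_congr (X := (A ⊗[ℂ] A) ⊗[ℂ] A) (Y := A ⊗[ℂ] (A ⊗[ℂ] A))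
      (TensorProduct.assoc ℂ A A A) (assoc_mul (X := A) (Y := A) (Z := A))
      (H.T₁ (p ⊗ₜ b) ⊗ₜ q)

private lemma incl_tensor_T₂ (H : AlgebraicQuantumGroup A) (a : A) (u : A ⊗[ℂ] A) :
    incl (A ⊗[ℂ] (A ⊗[ℂ] A)) (TensorProduct.map LinearMap.id
      (H.T₂.toLinearMap ∘ₗ (TensorProduct.mk ℂ A A).flip a) u) =
      idTensorComul H.comul u * tmul 1 (tmul 1 (incl A a)) := by
  induction u using TensorProduct.induction_on with
  | zero => rw [map_zero, map_zero, map_zero, zero_mul]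
  | add t t' h h' => rw [map_add, map_add, h, h', map_add, add_mul]
  | tmul p q =>
    rw [idTensorComul_tmul, tmul_mul, ← H.incl_T₂, mul_one, ← incl_tmul]
    rfl

/-- Coassociativity in the form
`(Δ ⊗ ι)(Δ(x)(1 ⊗ a)) (b ⊗ 1 ⊗ 1) = (ι ⊗ Δ)(Δ(x)(b ⊗ 1)) (1 ⊗ 1 ⊗ a)`. -/
lemma coassoc' (H : AlgebraicQuantumGroup A) (x a b : A) :
    TensorProduct.assoc ℂ A A A (TensorProduct.map
      (H.T₁.toLinearMap ∘ₗ (TensorProduct.mk ℂ A A).flip b) LinearMap.id (H.T₂ (x ⊗ₜ a))) =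
    TensorProduct.map LinearMap.id
      (H.T₂.toLinearMap ∘ₗ (TensorProduct.mk ℂ A A).flip a) (H.T₁ (x ⊗ₜ b)) := by
  apply incl_injective H.nondegenerate₃
  have hW := extend_spec H.nondegenerate₃ H.isNondegenerateHom_comulTensorId (H.comul x)
  have hW' := extend_spec H.nondegenerate₃ H.isNondegenerateHom_idTensorComul (H.comul x)
  rw [← H.coassoc] at hW'
  generalize extend (comulTensorId A H.comul) (H.comul x) = W at hW hW'
  have h1 : W * tmul 1 (tmul 1 (incl A a)) = comulTensorId A H.comul (H.T₂ (x ⊗ₜ a)) := by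
    apply H.isNondegenerateHom_comulTensorId.ext H.nondegenerate₃
    intro u
    rw [mul_assoc, one_tmul_mul_comulTensorId, (hW _).1, ← map_mul, ← mul_lmul_apply, ← H.incl_T₂,
      incl_lmul]
  have h2 : W * tmul (incl A b) 1 = idTensorComul H.comul (H.T₁ (x ⊗ₜ b)) := by
    apply H.isNondegenerateHom_idTensorComul.ext H.nondegenerate₃
    intro u
    rw [mul_assoc, tmul_one_mul_idTensorComul, (hW' _).1, ← map_mul, ← mul_lmul_apply, ← H.incl_T₁,
      incl_lmul]
  rw [incl_T₁_tensor, incl_tensor_T₂, ← h1, ← h2, mul_assoc, mul_assoc, tmul_mul, tmul_mul,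
    mul_one, one_mul, mul_one, one_mul]

/-! The dual algebra. -/

/-- The space `Â = {a φ | a ∈ A}` of functionals on `A`, where `(a φ)(x) = φ(x a)`. -/
def dual (H : AlgebraicQuantumGroup A) : Submodule ℂ (Module.Dual ℂ A) :=
  LinearMap.range ((actFunctional A).flip H.haar)

lemma mem_dual {H : AlgebraicQuantumGroup A} {ω : Module.Dual ℂ A} :
    ω ∈ H.dual ↔ ∃ a, ∀ x, ω x = H.haar (x * a) := by
  constructor
  · rintro ⟨a, rfl⟩; exact ⟨a, fun x => rfl⟩
  · rintro ⟨a, ha⟩; exact ⟨a, LinearMap.ext fun x => (ha x).symm⟩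

private lemma sliceSnd_map_id {X Y Z : Type*}
    [NonUnitalRing X] [Module ℂ X] [IsScalarTower ℂ X X] [SMulCommClass ℂ X X]
    [NonUnitalRing Y] [Module ℂ Y] [IsScalarTower ℂ Y Y] [SMulCommClass ℂ Y Y]
    [NonUnitalRing Z] [Module ℂ Z] [IsScalarTower ℂ Z Z] [SMulCommClass ℂ Z Z]
    (ω : Module.Dual ℂ Z) (f : Y →ₗ[ℂ] Z) (u : X ⊗[ℂ] Y) :
    sliceSnd ω (TensorProduct.map LinearMap.id f u) = sliceSnd (ω ∘ₗ f) u := by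
  induction u using TensorProduct.induction_on with
  | zero => simp
  | add t t' h h' => simp [h, h']
  | tmul x y => simp

private lemma sliceSnd_map_mulRight (ω : Module.Dual ℂ A) (b : A) (u : A ⊗[ℂ] A) :
    sliceSnd ω (TensorProduct.map (LinearMap.mulRight ℂ b) LinearMap.id u) = sliceSnd ω u * b := by
  induction u using TensorProduct.induction_on with
  | zero => simp
  | add t t' h h' => simp [h, h', add_mul]
  | tmul x y => simp [smul_mul_assoc]

private lemma sliceSnd_map_mulLeft (ω : Module.Dual ℂ A) (b : A) (u : A ⊗[ℂ] A) :
    sliceSnd ω (TensorProduct.map (LinearMap.mulLeft ℂ b) LinearMap.id u) = b * sliceSnd ω u := by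
  induction u using TensorProduct.induction_on with
  | zero => simp
  | add t t' h h' => simp [h, h', mul_add]
  | tmul x y => simp [mul_smul_comm]

lemma slice_spec (H : AlgebraicQuantumGroup A) {ω : Module.Dual ℂ A} {a : A}
    (ha : ∀ x, ω x = H.haar (x * a)) (x b : A) :
    sliceSnd H.haar (H.T₂ (x ⊗ₜ a)) * b = sliceSnd ω (H.T₁ (x ⊗ₜ b)) ∧
      b * sliceSnd H.haar (H.T₂ (x ⊗ₜ a)) = sliceSnd ω (H.T₃ (x ⊗ₜ b)) := by
  have hω : ω = H.haar ∘ₗ LinearMap.mulRight ℂ a := LinearMap.ext ha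
  subst hω
  rw [← sliceSnd_map_mulRight, ← sliceSnd_map_mulLeft, ← sliceSnd_map_id, ← sliceSnd_map_id]
  constructor
  · have h : (tmul (incl A b) 1).rmul (H.T₂ (x ⊗ₜ a)) = (tmul 1 (incl A a)).rmul (H.T₁ (x ⊗ₜ b)) := by
      apply incl_injective H.nondegenerate₂
      rw [← incl_mul, ← incl_mul, H.incl_T₁, H.incl_T₂, mul_assoc, mul_assoc, tmul_mul,
        tmul_mul, one_mul, mul_one, one_mul, mul_one]
    exact congrArg (sliceSnd H.haar) h
  · have h : (tmul (incl A b) 1).lmul (H.T₂ (x ⊗ₜ a)) = (tmul 1 (incl A a)).rmul (H.T₃ (x ⊗ₜ b)) := by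
      apply incl_injective H.nondegenerate₂
      rw [← incl_mul, ← mul_incl, H.incl_T₂, H.incl_T₃, mul_assoc]
    exact congrArg (sliceSnd H.haar) h

/-- For `ω ∈ Â` and `x ∈ A` the multiplier `(ι ⊗ ω)Δ(x)` belongs to `A`. -/
lemma exists_slice (H : AlgebraicQuantumGroup A) (ω : H.dual) (x : A) :
    ∃ y : A, ∀ b, y * b = sliceSnd ω.1 (H.T₁ (x ⊗ₜ b)) ∧
      b * y = sliceSnd ω.1 (H.T₃ (x ⊗ₜ b)) := by
  obtain ⟨a, ha⟩ := mem_dual.1 ω.2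
  exact ⟨_, H.slice_spec ha x⟩

private lemma eq_of_slice (H : AlgebraicQuantumGroup A) {y z : A} (h : ∀ b, y * b = z * b) :
    y = z :=
  sub_eq_zero.1 (H.nondegenerate.eq_zero_of_mul_right _ fun b => by rw [sub_mul, h, sub_self])

/-- The element `(ι ⊗ ω)Δ(x)` of `A`, for `ω ∈ Â` and `x ∈ A`: the unique `y ∈ A` with
`y b = (ι ⊗ ω)(Δ(x)(b ⊗ 1))` and `b y = (ι ⊗ ω)((b ⊗ 1)Δ(x))` for all `b`. -/
noncomputable def slice (H : AlgebraicQuantumGroup A) (ω : H.dual) : A →ₗ[ℂ] A where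
  toFun x := (H.exists_slice ω x).choose
  map_add' x y := H.eq_of_slice fun b => by
    rw [add_mul, ((H.exists_slice ω _).choose_spec b).1, ((H.exists_slice ω _).choose_spec b).1,
      ((H.exists_slice ω _).choose_spec b).1, TensorProduct.add_tmul, map_add, map_add]
  map_smul' c x := H.eq_of_slice fun b => by
    rw [RingHom.id_apply, smul_mul_assoc, ((H.exists_slice ω _).choose_spec b).1,
      ((H.exists_slice ω _).choose_spec b).1, ← TensorProduct.smul_tmul', map_smul, map_smul]

lemma slice_mul (H : AlgebraicQuantumGroup A) (ω : H.dual) (x b : A) :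
    H.slice ω x * b = sliceSnd ω.1 (H.T₁ (x ⊗ₜ b)) :=
  ((H.exists_slice ω x).choose_spec b).1

lemma mul_slice (H : AlgebraicQuantumGroup A) (ω : H.dual) (x b : A) :
    b * H.slice ω x = sliceSnd ω.1 (H.T₃ (x ⊗ₜ b)) :=
  ((H.exists_slice ω x).choose_spec b).2

lemma slice_eq (H : AlgebraicQuantumGroup A) {ω : H.dual} {a : A}
    (ha : ∀ x, ω.1 x = H.haar (x * a)) (x : A) :
    H.slice ω x = sliceSnd H.haar (H.T₂ (x ⊗ₜ a)) :=
  H.eq_of_slice fun b => by rw [H.slice_mul, (H.slice_spec ha x b).1]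

lemma mul_mem_dual (H : AlgebraicQuantumGroup A) (ω η : H.dual) :
    ω.1 ∘ₗ H.slice η ∈ H.dual := by
  obtain ⟨a, ha⟩ := mem_dual.1 ω.2
  obtain ⟨b, hb⟩ := mem_dual.1 η.2
  rw [mem_dual]
  refine ⟨sliceSnd H.haar (H.T₁.symm (a ⊗ₜ b)), fun x => ?_⟩
  rw [LinearMap.comp_apply, ha, H.slice_mul]
  have hη : η.1 = H.haar ∘ₗ LinearMap.mulRight ℂ b := LinearMap.ext hb
  rw [hη, ← sliceSnd_map_id, ← comul_lmul_tmul]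
  obtain ⟨u, hu⟩ := H.T₁.surjective (a ⊗ₜ b)
  rw [← hu, LinearEquiv.symm_apply_apply]
  clear hu
  induction u using TensorProduct.induction_on with
  | zero => simp
  | add t t' h h' => simp only [map_add, mul_add, h, h']
  | tmul p q =>
    have : (H.comul x).lmul (H.T₁ (p ⊗ₜ q)) = H.T₁ ((x * p) ⊗ₜ q) := by
      apply incl_injective H.nondegenerate₂
      rw [← mul_incl, H.incl_T₁, H.incl_T₁, map_mul, mul_assoc]
    rw [this, (H.haar_leftInvariant _ _).1, sliceSnd_tmul, map_smul, mul_smul_comm, map_smul,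
      smul_eq_mul, smul_eq_mul, mul_comm]

/-- The product of `Â`: `(ω η)(x) = ω((ι ⊗ η)Δ(x))`. -/
noncomputable instance (H : AlgebraicQuantumGroup A) : Mul H.dual where
  mul ω η := ⟨ω.1 ∘ₗ H.slice η, H.mul_mem_dual ω η⟩

lemma dual_mul_apply (H : AlgebraicQuantumGroup A) (ω η : H.dual) (x : A) :
    (ω * η).1 x = ω.1 (H.slice η x) := rfl

private lemma T₁_slice (H : AlgebraicQuantumGroup A) (ω : H.dual) (x b : A) :
    H.T₁ (H.slice ω x ⊗ₜ b) = TensorProduct.map LinearMap.id (H.slice ω) (H.T₁ (x ⊗ₜ b)) := by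
  obtain ⟨a, ha⟩ := mem_dual.1 ω.2
  have h := congrArg (TensorProduct.map LinearMap.id (sliceSnd H.haar)) (H.coassoc' x a b)
  have h1 : ∀ u : A ⊗[ℂ] A, TensorProduct.map LinearMap.id (sliceSnd H.haar)
      (TensorProduct.assoc ℂ A A A (TensorProduct.map
        (H.T₁.toLinearMap ∘ₗ (TensorProduct.mk ℂ A A).flip b) LinearMap.id u)) =
      H.T₁ (sliceSnd H.haar u ⊗ₜ b) := by
    intro u
    induction u using TensorProduct.induction_on with
    | zero => simp
    | add t t' h h' => simp only [map_add, h, h', TensorProduct.add_tmul]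
    | tmul p q =>
      rw [TensorProduct.map_tmul, sliceSnd_tmul, ← TensorProduct.smul_tmul', map_smul]
      change TensorProduct.map LinearMap.id (sliceSnd H.haar)
        (TensorProduct.assoc ℂ A A A (H.T₁ (p ⊗ₜ b) ⊗ₜ q)) = _
      generalize H.T₁ (p ⊗ₜ b) = v
      induction v using TensorProduct.induction_on with
      | zero => simp
      | add t t' h h' => simp only [map_add, h, h', TensorProduct.add_tmul, smul_add]
      | tmul r s => simp
  have h2 : ∀ u : A ⊗[ℂ] A, TensorProduct.map LinearMap.id (sliceSnd H.haar)
      (TensorProduct.map LinearMap.id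
        (H.T₂.toLinearMap ∘ₗ (TensorProduct.mk ℂ A A).flip a) u) =
      TensorProduct.map LinearMap.id (H.slice ω) u := by
    intro u
    induction u using TensorProduct.induction_on with
    | zero => simp
    | add t t' h h' => simp only [map_add, h, h']
    | tmul p q => simp [H.slice_eq ha]
  rw [h1, h2] at h
  rw [H.slice_eq ha, h]

lemma slice_mul_eq_comp (H : AlgebraicQuantumGroup A) (ω η : H.dual) (x : A) :
    H.slice (ω * η) x = H.slice ω (H.slice η x) :=
  H.eq_of_slice fun b => by
    rw [H.slice_mul, H.slice_mul, T₁_slice, sliceSnd_map_id]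
    rfl

private lemma slice_add (H : AlgebraicQuantumGroup A) (ω η : H.dual) (x : A) :
    H.slice (ω + η) x = H.slice ω x + H.slice η x :=
  H.eq_of_slice fun b => by
    rw [add_mul, H.slice_mul, H.slice_mul, H.slice_mul]
    generalize H.T₁ (x ⊗ₜ b) = u
    induction u using TensorProduct.induction_on with
    | zero => simp
    | add t t' h h' => simp only [map_add, h, h']; abel
    | tmul p q => simp [add_smul]

private lemma slice_smul (H : AlgebraicQuantumGroup A) (c : ℂ) (ω : H.dual) (x : A) :
    H.slice (c • ω) x = c • H.slice ω x :=
  H.eq_of_slice fun b => by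
    rw [smul_mul_assoc, H.slice_mul, H.slice_mul]
    generalize H.T₁ (x ⊗ₜ b) = u
    induction u using TensorProduct.induction_on with
    | zero => simp
    | add t t' h h' => simp only [map_add, h, h', smul_add]
    | tmul p q => simp [mul_smul]

private lemma dual_ext {H : AlgebraicQuantumGroup A} {ω η : H.dual} (h : ∀ x, ω.1 x = η.1 x) :
    ω = η := Subtype.ext (LinearMap.ext h)

private lemma slice_zero (H : AlgebraicQuantumGroup A) (x : A) : H.slice 0 x = 0 := by
  have := H.slice_smul 0 0 x
  rwa [zero_smul, zero_smul] at this

/-- The algebra `Â`. -/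
noncomputable instance (H : AlgebraicQuantumGroup A) : NonUnitalRing H.dual where
  left_distrib ω η θ := dual_ext fun x => by
    change ω.1 (H.slice (η + θ) x) = ω.1 (H.slice η x) + ω.1 (H.slice θ x)
    rw [slice_add, map_add]
  right_distrib ω η θ := rfl
  zero_mul ω := rfl
  mul_zero ω := dual_ext fun x => by
    change ω.1 (H.slice 0 x) = 0
    rw [slice_zero, map_zero]
  mul_assoc ω η θ := dual_ext fun x => by
    change ω.1 (H.slice η (H.slice θ x)) = ω.1 (H.slice (η * θ) x)
    rw [slice_mul_eq_comp]

instance (H : AlgebraicQuantumGroup A) : IsScalarTower ℂ H.dual H.dual :=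
  ⟨fun _ _ _ => rfl⟩

instance (H : AlgebraicQuantumGroup A) : SMulCommClass ℂ H.dual H.dual :=
  ⟨fun c ω η => dual_ext fun x => by
    change c • ω.1 (H.slice η x) = ω.1 (H.slice (c • η) x)
    rw [slice_smul, map_smul]⟩

end AlgebraicQuantumGroup

end Dual

/-! ### Corepresentations and the universal corepresentation -/

section Corepresentation

variable {A B : Type*} [NonUnitalRing A] [Module ℂ A] [IsScalarTower ℂ A A] [SMulCommClass ℂ A A]
  [NonUnitalRing B] [Module ℂ B] [IsScalarTower ℂ B B] [SMulCommClass ℂ B B]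

/-- `V ∈ M(A ⊗ B)` is a corepresentation of `(A, Δ)` on `B` if `(Δ ⊗ ι)(V) = V₁₃ V₂₃`. It is
called non-degenerate if it is invertible in `M(A ⊗ B)`. -/
def RegularMultiplierHopfAlgebra.IsCorepresentation (H : RegularMultiplierHopfAlgebra A)
    (V : Mult (A ⊗[ℂ] B)) : Prop :=
  extend (comulTensorId B H.comul) V = leg₁₃ V * leg₂₃ V

/-- `L : B → B` is the left multiplier `(θ ⊗ ι)(V)`, for `V ∈ M(A ⊗ B)` and `θ` in the span of the
functionals `a ω`: it is determined by linearity in `θ` and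
`((a ω) ⊗ ι)(V) x = (ω ⊗ ι)(V (a ⊗ x))`. -/
def IsLeftSlice (V : Mult (A ⊗[ℂ] B)) (θ : Module.Dual ℂ A) (L : B →ₗ[ℂ] B) : Prop :=
  ∀ (n : ℕ) (a : Fin n → A) (ω : Fin n → Module.Dual ℂ A),
    θ = ∑ i, actFunctional A (a i) (ω i) →
      ∀ x : B, L x = ∑ i, sliceFst (ω i) (V.lmul (a i ⊗ₜ[ℂ] x))

namespace AlgebraicQuantumGroup

open Classical in
/-- The map `π_V : Â → M(B)`, `π_V(ω) = (ω ⊗ ι)(V)`: the multiplier of the non-degenerate algebra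
`B` whose left multiplication is the left multiplier `(ω ⊗ ι)(V)`. -/
noncomputable def rep (H : AlgebraicQuantumGroup A) (V : Mult (A ⊗[ℂ] B)) (ω : H.dual) : Mult B :=
  if h : ∃ m : Mult B, IsLeftSlice V ω.1 m.lmul then h.choose else 0

/-- An element of `A ⊗ Â` as a linear operator on `A`: `(x ⊗ ω)(y) = ω(y) x`. -/
def toOperator (H : AlgebraicQuantumGroup A) : A ⊗[ℂ] H.dual →ₗ[ℂ] A →ₗ[ℂ] A :=
  TensorProduct.lift (LinearMap.mk₂ ℂ (fun x ω => ω.1.smulRight x)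
    (fun x x' ω => by ext y; simp) (fun c x ω => by ext y; exact smul_comm _ _ _)
    (fun x ω ω' => by ext y; simp [add_smul]) (fun c x ω => by ext y; simp [mul_smul]))

/-- `U ∈ M(A ⊗ Â)` is the universal corepresentation of `(A, Δ)`:
`[U (x ⊗ ω)](y) = (ι ⊗ ω)(Δ(y)(x ⊗ 1))` and `[(x ⊗ ω) U](y) = (ω ⊗ ι)((1 ⊗ x)Δ(y))`. -/
def IsUniversal (H : AlgebraicQuantumGroup A) (U : Mult (A ⊗[ℂ] H.dual)) : Prop :=
  ∀ (x : A) (ω : H.dual) (y : A),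
    H.toOperator (U.lmul (x ⊗ₜ ω)) y = sliceSnd ω.1 (H.T₁ (y ⊗ₜ x)) ∧
    H.toOperator (U.rmul (x ⊗ₜ ω)) y = sliceFst ω.1 (H.T₄ (y ⊗ₜ x))

end AlgebraicQuantumGroup

end Corepresentation

end QuantumGroup

namespace QuantumGroup

open Mult

/-! In formal Sweedler notation, the product of `Â` is convolution, so `A ⊗ Â` is an algebra of
operators on `A` with product `(s t)(y) = s(y₁) t(y₂)`. The two formulas defining `U` read `(U t)(y)
= y₁ t(y₂)` and `(t U)(y) = t(y₁) y₂`: `U` is the identity map of `A`, viewed as a multiplier of a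
convolution algebra. This explains every claim. Both `s (U t)` and `(s U) t` are `y ↦ s(y₁) y₂
t(y₃)`; slicing the identity map by `ω` returns `ω`; and `(Δ ⊗ ι)(U)` and `U₁₃ U₂₃` both represent
`y ↦ Δ(y) = (y₁ ⊗ 1)(1 ⊗ y₂)`.

The substance is that the two formulas map `A ⊗ Â` bijectively onto itself. The embedding
`toOperator` is compared with `leftOperator` and `rightOperator`, which encode the formulas. The
latter two are injective because `T₃` and `T₂` are onto. Left invariance of `φ` gives
`range_leftOperator`. For `range_rightOperator` a right invariant `ψ` with `Â = {a ψ}` is needed; it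
is not part of the data, so the counit, the antipode `S` and `ψ = φ ∘ S` are first built from the
canonical bijections (`exists_counit`, `T₁_map_antipode_T₂`, `mem_dual_iff_rightHaar`).

Equality of ranges turns `t ↦ U t` and `t ↦ t U` into linear automorphisms, and a multiplier whose
two sides are bijective is invertible, so no inverse has to be written down. Uniqueness is the
injectivity of `toOperator`. -/

lemma exists_linearEquiv_of_range_eq {V W : Type*} [AddCommGroup V] [Module ℂ V] [AddCommGroup W]
    [Module ℂ W] {f g : V →ₗ[ℂ] W} (hf : Function.Injective f) (hg : Function.Injective g)
    (h : LinearMap.range f = LinearMap.range g) : ∃ e : V ≃ₗ[ℂ] V, ∀ v, g (e v) = f v := by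
  refine ⟨LinearEquiv.ofInjective f hf ≪≫ₗ LinearEquiv.ofEq _ _ h ≪≫ₗ
    (LinearEquiv.ofInjective g hg).symm, fun v => ?_⟩
  exact congrArg Subtype.val ((LinearEquiv.ofInjective g hg).apply_symm_apply
    (LinearEquiv.ofEq _ _ h (LinearEquiv.ofInjective f hf v)))

/-- Meant for `f` equal to `leftOperator` or `rightOperator` and `g = toOperator`: invariance
computes the operator `f (p v)` only in coordinates adapted to a canonical bijection, and `p` and
`q` are these changes of coordinates. -/
lemma range_eq_of_comp_surjective {V V' W : Type*} [AddCommGroup V] [Module ℂ V] [AddCommGroup V']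
    [Module ℂ V'] [AddCommGroup W] [Module ℂ W] {f g : V →ₗ[ℂ] W} {p q : V' →ₗ[ℂ] V}
    (hp : Function.Surjective p) (hq : Function.Surjective q) (h : ∀ v, f (p v) = g (q v)) :
    LinearMap.range f = LinearMap.range g := by
  rw [← LinearMap.range_comp_of_range_eq_top f (LinearMap.range_eq_top.2 hp),
    ← LinearMap.range_comp_of_range_eq_top g (LinearMap.range_eq_top.2 hq)]
  exact congrArg LinearMap.range (LinearMap.ext h)

/-! ### Multipliers from compatible pairs of maps. -/

section Slices

variable {X Y : Type*}
  [NonUnitalRing X] [Module ℂ X] [IsScalarTower ℂ X X] [SMulCommClass ℂ X X]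
  [NonUnitalRing Y] [Module ℂ Y] [IsScalarTower ℂ Y Y] [SMulCommClass ℂ Y Y]

lemma sliceFst_add (ω η : Module.Dual ℂ X) (u : X ⊗[ℂ] Y) :
    sliceFst (ω + η) u = sliceFst ω u + sliceFst η u := by
  simp [sliceFst, TensorProduct.map_add_left]

lemma sliceFst_smul (c : ℂ) (ω : Module.Dual ℂ X) (u : X ⊗[ℂ] Y) :
    sliceFst (c • ω) u = c • sliceFst ω u := by
  simp [sliceFst, TensorProduct.map_smul_left]

/-- A pair of compatible linear maps on a non-degenerate algebra is a multiplier. -/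
lemma IsNondegenerate.exists_mult (hX : IsNondegenerate X) (L R : X →ₗ[ℂ] X)
    (h : ∀ a b, a * L b = R a * b) : ∃ m : Mult X, m.lmul = L ∧ m.rmul = R :=
  ⟨Mult.mk L R
    (fun a b => sub_eq_zero.1 (hX.eq_zero_of_mul_left _ fun c => by
      rw [mul_sub, h, ← mul_assoc, ← mul_assoc, h, sub_self]))
    (fun a b => sub_eq_zero.1 (hX.eq_zero_of_mul_right _ fun c => by
      rw [sub_mul, ← h, mul_assoc, mul_assoc, h, sub_self])) h, rfl, rfl⟩

/-- A multiplier with bijective left and right multiplications is invertible. -/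
lemma Mult.isUnit_of_bijective (m : Mult X) (hl : Function.Bijective m.lmul)
    (hr : Function.Bijective m.rmul) : IsUnit m := by
  let L := LinearEquiv.ofBijective m.lmul hl
  let R := LinearEquiv.ofBijective m.rmul hr
  have hL : ∀ x, m.lmul (L.symm x) = x := L.apply_symm_apply
  have hL' : ∀ x, L.symm (m.lmul x) = x := L.symm_apply_apply
  have hR : ∀ x, m.rmul (R.symm x) = x := R.apply_symm_apply
  have hR' : ∀ x, R.symm (m.rmul x) = x := R.symm_apply_apply
  let n : Mult X := Mult.mk L.symm.toLinearMap R.symm.toLinearMap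
    (fun a b => by
      apply hl.1
      rw [lmul_mul]
      simp [hL])
    (fun a b => by
      apply hr.1
      rw [rmul_mul]
      simp [hR])
    (fun a b => by
      have h := m.mul_lmul (R.symm a) (L.symm b)
      rw [hL, hR] at h
      exact h.symm)
  refine ⟨⟨m, n, ?_, ?_⟩, rfl⟩
  · ext x
    · exact hL x
    · exact hR' x
  · ext x
    · exact hL' x
    · exact hR x

end Slices

/-! ### Slice maps, and separation of tensors by multiplication on one leg. -/

section Legs

variable {X Y Z : Type*}
  [NonUnitalRing X] [Module ℂ X] [IsScalarTower ℂ X X] [SMulCommClass ℂ X X]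
  [NonUnitalRing Y] [Module ℂ Y] [IsScalarTower ℂ Y Y] [SMulCommClass ℂ Y Y]

lemma sliceSnd_map_mulRight_id (ω : Module.Dual ℂ Y) (b : X) (u : X ⊗[ℂ] Y) :
    sliceSnd ω (TensorProduct.map (LinearMap.mulRight ℂ b) LinearMap.id u) = sliceSnd ω u * b := by
  induction u using TensorProduct.induction_on with
  | zero => simp
  | add t t' h h' => simp [h, h', add_mul]
  | tmul x y => simp [smul_mul_assoc]

lemma sliceFst_map_id_mulRight (ω : Module.Dual ℂ X) (b : Y) (u : X ⊗[ℂ] Y) :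
    sliceFst ω (TensorProduct.map LinearMap.id (LinearMap.mulRight ℂ b) u) = sliceFst ω u * b := by
  induction u using TensorProduct.induction_on with
  | zero => simp
  | add t t' h h' => simp [h, h', add_mul]
  | tmul x y => simp [smul_mul_assoc]

lemma sliceFst_map_id_mulLeft (ω : Module.Dual ℂ X) (b : Y) (u : X ⊗[ℂ] Y) :
    sliceFst ω (TensorProduct.map LinearMap.id (LinearMap.mulLeft ℂ b) u) = b * sliceFst ω u := by
  induction u using TensorProduct.induction_on with
  | zero => simp
  | add t t' h h' => simp [h, h', mul_add]
  | tmul x y => simp [mul_smul_comm]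

lemma sliceFst_map_fst (ω : Module.Dual ℂ X) (f : X →ₗ[ℂ] X) (u : X ⊗[ℂ] Y) :
    sliceFst ω (TensorProduct.map f LinearMap.id u) = sliceFst (ω ∘ₗ f) u := by
  induction u using TensorProduct.induction_on with
  | zero => simp
  | add t t' h h' => simp [h, h']
  | tmul x y => simp

/-- Both sides are `(ω ⊗ η)(u)`; this is the exchange of two slices used in all invariance
arguments. -/
lemma apply_sliceSnd (ω : Module.Dual ℂ X) (η : Module.Dual ℂ Y) (u : X ⊗[ℂ] Y) :
    ω (sliceSnd η u) = η (sliceFst ω u) := by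
  induction u using TensorProduct.induction_on with
  | zero => simp
  | add t t' h h' => simp [h, h']
  | tmul x y => simp [mul_comm]

/-- Elements of `X ⊗ Y` are separated by right multiplication on the first leg. -/
lemma IsNondegenerate.ext_map_mulRight_id (hX : IsNondegenerate X) {u v : X ⊗[ℂ] Y}
    (h : ∀ b, TensorProduct.map (LinearMap.mulRight ℂ b) LinearMap.id u =
      TensorProduct.map (LinearMap.mulRight ℂ b) LinearMap.id v) : u = v := by
  refine sub_eq_zero.1 (eq_zero_of_sliceSnd fun ω => hX.eq_zero_of_mul_right _ fun b => ?_)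
  rw [← sliceSnd_map_mulRight_id, map_sub, h, sub_self, map_zero]

/-- Elements of `X ⊗ Y` are separated by right multiplication on the second leg. -/
lemma IsNondegenerate.ext_map_id_mulRight (hY : IsNondegenerate Y) {u v : X ⊗[ℂ] Y}
    (h : ∀ b, TensorProduct.map LinearMap.id (LinearMap.mulRight ℂ b) u =
      TensorProduct.map LinearMap.id (LinearMap.mulRight ℂ b) v) : u = v := by
  refine sub_eq_zero.1 (eq_zero_of_sliceFst fun ω => hY.eq_zero_of_mul_right _ fun b => ?_)
  rw [← sliceFst_map_id_mulRight, map_sub, h, sub_self, map_zero]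

/-- Two elements of a non-degenerate algebra with the same left multiplications agree. -/
lemma IsNondegenerate.ext_mul_right (hX : IsNondegenerate X) {x y : X}
    (h : ∀ b, x * b = y * b) : x = y :=
  sub_eq_zero.1 (hX.eq_zero_of_mul_right _ fun b => by rw [sub_mul, h, sub_self])

end Legs

/-! ### Left multiplication by `Δ(x)` and its relations with the canonical bijections. -/

namespace AlgebraicQuantumGroup

variable {A : Type*} [NonUnitalRing A] [Module ℂ A] [IsScalarTower ℂ A A] [SMulCommClass ℂ A A]
  (H : AlgebraicQuantumGroup A)

/-- The linear map `x ↦ (u ↦ Δ(x) u)`. -/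
noncomputable def comulLeft : A →ₗ[ℂ] A ⊗[ℂ] A →ₗ[ℂ] A ⊗[ℂ] A where
  toFun x := (H.comul x).lmul
  map_add' x y := by ext; simp
  map_smul' c x := by ext; simp

lemma comulLeft_apply (x : A) (u : A ⊗[ℂ] A) : H.comulLeft x u = (H.comul x).lmul u := rfl

lemma comulLeft_tmul (x b c : A) : H.comulLeft x (b ⊗ₜ c) =
    TensorProduct.map LinearMap.id (LinearMap.mulRight ℂ c) (H.T₁ (x ⊗ₜ b)) :=
  H.comul_lmul_tmul x b c

/-- Together with `comulLeft_tmul` this reads `Δ(x)(b ⊗ c)` through `T₁` or through `T₂`, which is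
how the two bijections are exchanged later. -/
lemma comulLeft_tmul' (x b c : A) : H.comulLeft x (b ⊗ₜ c) =
    TensorProduct.map (LinearMap.mulRight ℂ b) LinearMap.id (H.T₂ (x ⊗ₜ c)) := by
  apply incl_injective H.nondegenerate₂
  have h : TensorProduct.map (LinearMap.mulRight ℂ b) LinearMap.id (H.T₂ (x ⊗ₜ c)) =
    (tmul (incl A b) 1).rmul (H.T₂ (x ⊗ₜ c)) := rfl
  rw [h, comulLeft_apply, ← mul_incl, ← incl_mul, H.incl_T₂, incl_tmul,
    mul_assoc, tmul_mul, mul_one, one_mul]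

lemma comulLeft_T₁ (x p q : A) : H.comulLeft x (H.T₁ (p ⊗ₜ q)) = H.T₁ ((x * p) ⊗ₜ q) := by
  apply incl_injective H.nondegenerate₂
  rw [comulLeft_apply, ← mul_incl, H.incl_T₁, H.incl_T₁, map_mul,
    mul_assoc]

lemma comulLeft_T₂ (x p q : A) : H.comulLeft x (H.T₂ (p ⊗ₜ q)) = H.T₂ ((x * p) ⊗ₜ q) := by
  apply incl_injective H.nondegenerate₂
  rw [comulLeft_apply, ← mul_incl, H.incl_T₂, H.incl_T₂, map_mul,
    mul_assoc]

/-- This and the next two lemmas are associativity in `M(A ⊗ A)` for `Δ(a)` with one factor on each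
side. -/
lemma map_mulLeft_T₁ (a b c : A) :
    TensorProduct.map (LinearMap.mulLeft ℂ c) LinearMap.id (H.T₁ (a ⊗ₜ b)) =
      TensorProduct.map (LinearMap.mulRight ℂ b) LinearMap.id (H.T₃ (a ⊗ₜ c)) := by
  have h : (tmul (incl A c) 1).lmul (H.T₁ (a ⊗ₜ b)) = (tmul (incl A b) 1).rmul (H.T₃ (a ⊗ₜ c)) := by
    apply incl_injective H.nondegenerate₂
    rw [← incl_mul, ← mul_incl, H.incl_T₁, H.incl_T₃, mul_assoc]
  exact h

lemma map_id_mulLeft_T₁ (a b c : A) :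
    TensorProduct.map LinearMap.id (LinearMap.mulLeft ℂ c) (H.T₁ (a ⊗ₜ b)) =
      TensorProduct.map (LinearMap.mulRight ℂ b) LinearMap.id (H.T₄ (a ⊗ₜ c)) := by
  have h : (tmul 1 (incl A c)).lmul (H.T₁ (a ⊗ₜ b)) = (tmul (incl A b) 1).rmul (H.T₄ (a ⊗ₜ c)) := by
    apply incl_injective H.nondegenerate₂
    rw [← incl_mul, ← mul_incl, H.incl_T₁, H.incl_T₄, mul_assoc]
  exact h

lemma map_id_mulLeft_T₂ (a b c : A) :
    TensorProduct.map LinearMap.id (LinearMap.mulLeft ℂ c) (H.T₂ (a ⊗ₜ b)) =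
      TensorProduct.map LinearMap.id (LinearMap.mulRight ℂ b) (H.T₄ (a ⊗ₜ c)) := by
  have h : (tmul 1 (incl A c)).lmul (H.T₂ (a ⊗ₜ b)) = (tmul 1 (incl A b)).rmul (H.T₄ (a ⊗ₜ c)) := by
    apply incl_injective H.nondegenerate₂
    rw [← incl_mul, ← mul_incl, H.incl_T₂, H.incl_T₄, mul_assoc]
  exact h

lemma map_id_mulRight_T₂ (a b c : A) :
    TensorProduct.map LinearMap.id (LinearMap.mulRight ℂ c) (H.T₂ (a ⊗ₜ b)) =
      H.T₂ (a ⊗ₜ (b * c)) := by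
  have h : (tmul 1 (incl A c)).rmul (H.T₂ (a ⊗ₜ b)) = H.T₂ (a ⊗ₜ (b * c)) := by
    apply incl_injective H.nondegenerate₂
    rw [← incl_mul, H.incl_T₂, H.incl_T₂, mul_assoc, tmul_mul, one_mul, map_mul]
  exact h

lemma exists_haar_eq_one : ∃ d, H.haar d = 1 := by
  obtain ⟨d, hd⟩ : ∃ d, H.haar d ≠ 0 := by
    by_contra! h
    exact H.haar_ne_zero (LinearMap.ext h)
  exact ⟨(H.haar d)⁻¹ • d, by simp [hd]⟩

/-! ### The counit -/

/-- For `w = p ⊗ q`, coassociativity makes the last two legs a value of `T₂`, so `T₂.symm` cancels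
and multiplication leaves `Δ(p)(c ⊗ q)`. -/
lemma map_mul'_T₂_symm (c : A) (w : A ⊗[ℂ] A) :
    TensorProduct.map LinearMap.id (LinearMap.mul' ℂ A ∘ₗ H.T₂.symm.toLinearMap)
      (TensorProduct.assoc ℂ A A A (TensorProduct.map
        (H.T₁.toLinearMap ∘ₗ (TensorProduct.mk ℂ A A).flip c) LinearMap.id (H.T₂ w))) =
    TensorProduct.map (LinearMap.mulRight ℂ c) LinearMap.id (H.T₂ w) := by
  induction w using TensorProduct.induction_on with
  | zero => simp
  | add t t' h h' => simp only [map_add, h, h']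
  | tmul p q =>
    rw [coassoc', ← comulLeft_tmul', comulLeft_tmul, ← LinearMap.comp_apply,
      ← TensorProduct.map_comp]
    congr 2
    ext y
    simp

/-- A counit. -/
lemma exists_counit : ∃ ε : Module.Dual ℂ A, (∀ u, sliceFst ε (H.T₂ u) = LinearMap.mul' ℂ A u) ∧
    ∀ u, sliceSnd ε (H.T₁ u) = LinearMap.mul' ℂ A u := by
  obtain ⟨d, hd⟩ := H.exists_haar_eq_one
  -- As `T₂` is onto, the previous lemma holds with any `a ⊗ b` in place of `T₂ w`.
  have h1 : ∀ b u, TensorProduct.map LinearMap.id (LinearMap.mul' ℂ A ∘ₗ H.T₂.symm.toLinearMap)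
      (TensorProduct.assoc ℂ A A A (H.T₁ u ⊗ₜ b)) = LinearMap.mul' ℂ A u ⊗ₜ b := by
    intro b u
    induction u using TensorProduct.induction_on with
    | zero => simp
    | add t t' h h' => simp only [map_add, TensorProduct.add_tmul, h, h']
    | tmul a c => simpa using H.map_mul'_T₂_symm c (H.T₂.symm (a ⊗ₜ b))
  -- Separation of variables: the left side is a multiple of `x` in the first leg and the right side
  -- of `b` in the second, so both must be `ε(y) x ⊗ b` for a scalar `ε(y)`. Slicing by `φ` against
  -- `d` with `φ(d) = 1` extracts it.
  have h2 : ∀ x y b, x ⊗ₜ[ℂ] LinearMap.mul' ℂ A (H.T₂.symm (y ⊗ₜ b)) =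
      LinearMap.mul' ℂ A (H.T₁.symm (x ⊗ₜ y)) ⊗ₜ b := by
    intro x y b
    simpa using h1 b (H.T₁.symm (x ⊗ₜ y))
  let ε : Module.Dual ℂ A :=
    H.haar ∘ₗ LinearMap.mul' ℂ A ∘ₗ H.T₁.symm.toLinearMap ∘ₗ TensorProduct.mk ℂ A A d
  have hε : ∀ y, ε y = H.haar (LinearMap.mul' ℂ A (H.T₁.symm (d ⊗ₜ y))) := fun y => rfl
  have h3 : ∀ y b, LinearMap.mul' ℂ A (H.T₂.symm (y ⊗ₜ b)) = ε y • b := by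
    intro y b
    simpa [hd, hε] using congrArg (sliceFst H.haar) (h2 d y b)
  have h4 : ∀ x y, LinearMap.mul' ℂ A (H.T₁.symm (x ⊗ₜ y)) = ε y • x := by
    intro x y
    have := congrArg (sliceSnd H.haar) (h2 x y d)
    rw [h3] at this
    simpa [hd] using this.symm
  refine ⟨ε, fun u => ?_, fun u => ?_⟩
  · have : sliceFst ε = LinearMap.mul' ℂ A ∘ₗ H.T₂.symm.toLinearMap :=
      TensorProduct.ext' fun y b => by simp [h3]
    simp [this]
  · have : sliceSnd ε = LinearMap.mul' ℂ A ∘ₗ H.T₁.symm.toLinearMap :=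
      TensorProduct.ext' fun y b => by simp [h4]
    simp [this]

/-- The counit `ε`. -/
noncomputable def counit : Module.Dual ℂ A := H.exists_counit.choose

lemma sliceFst_counit_T₂ (u : A ⊗[ℂ] A) : sliceFst H.counit (H.T₂ u) = LinearMap.mul' ℂ A u :=
  H.exists_counit.choose_spec.1 u

lemma sliceSnd_counit_T₁ (u : A ⊗[ℂ] A) : sliceSnd H.counit (H.T₁ u) = LinearMap.mul' ℂ A u :=
  H.exists_counit.choose_spec.2 u

lemma exists_counit_eq_one : ∃ e, H.counit e = 1 := by
  obtain ⟨e, he⟩ : ∃ e, H.counit e ≠ 0 := by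
    by_contra! h
    obtain ⟨d, hd⟩ := H.exists_haar_eq_one
    have h0 : H.counit = 0 := LinearMap.ext h
    -- If `ε` vanished, slicing `T₁ (d ⊗ b)` by `ε` would give `d b = 0` for all `b`.
    have : d = 0 := H.nondegenerate.eq_zero_of_mul_right _ fun b => by
      have := H.sliceSnd_counit_T₁ (d ⊗ₜ b)
      rw [h0, LinearMap.mul'_apply] at this
      rw [← this]
      simp [sliceSnd]
    simp [this] at hd
  exact ⟨(H.counit e)⁻¹ • e, by simp [he]⟩

lemma sliceFst_counit_comulLeft (a : A) (u : A ⊗[ℂ] A) :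
    sliceFst H.counit (H.comulLeft a u) = a * sliceFst H.counit u := by
  obtain ⟨w, rfl⟩ := H.T₂.surjective u
  induction w using TensorProduct.induction_on with
  | zero => simp
  | add t t' h h' => simp only [map_add, mul_add, h, h']
  | tmul p q =>
    rw [comulLeft_T₂, sliceFst_counit_T₂, sliceFst_counit_T₂]
    simp [mul_assoc]

/-- Slicing `Δ(a)(y ⊗ v)` by `ε` gives `ε(y) a v`, which is `ε(y)` times the slice of `Δ(a)(1 ⊗ v)`.
Since `T₂` is onto, the latter may be replaced by any `x ⊗ d`. -/
lemma counit_mul (x y : A) : H.counit (x * y) = H.counit x * H.counit y := by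
  obtain ⟨d, hd⟩ := H.exists_haar_eq_one
  have h : ∀ w, sliceFst H.counit
      (TensorProduct.map (LinearMap.mulRight ℂ y) LinearMap.id (H.T₂ w)) =
      H.counit y • sliceFst H.counit (H.T₂ w) := by
    intro w
    induction w using TensorProduct.induction_on with
    | zero => simp
    | add t t' h h' => simp only [map_add, smul_add, h, h']
    | tmul a v =>
      rw [← comulLeft_tmul', sliceFst_counit_comulLeft, sliceFst_counit_T₂]
      simp [mul_smul_comm]
  have := congrArg H.haar (h (H.T₂.symm (x ⊗ₜ d)))
  simpa [hd, mul_comm] using this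

/-- Multiplicativity of `ε` moves `r` out of the slice; what remains is the counit identity for
`T₁`. -/
lemma sliceSnd_counit_T₂ (p r : A) : sliceSnd H.counit (H.T₂ (p ⊗ₜ r)) = H.counit r • p := by
  apply H.nondegenerate.ext_mul_right
  intro b
  rw [← sliceSnd_map_mulRight_id, ← comulLeft_tmul', comulLeft_tmul, sliceSnd_map_id]
  have : H.counit ∘ₗ LinearMap.mulRight ℂ r = H.counit r • H.counit := by
    ext x; simp [counit_mul, mul_comm]
  rw [this]
  have h : ∀ u : A ⊗[ℂ] A, sliceSnd (H.counit r • H.counit) u = H.counit r • sliceSnd H.counit u := by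
    intro u
    induction u using TensorProduct.induction_on with
    | zero => simp
    | add t t' h h' => simp only [map_add, smul_add, h, h']
    | tmul a v => simp [mul_smul]
  rw [h, sliceSnd_counit_T₁]
  simp [smul_mul_assoc]

/-! ### The antipode -/

/-- The map `a ⊗ b ↦ S(a) b`, in terms of which the antipode `S` is defined. -/
noncomputable def antipodeMul : A ⊗[ℂ] A →ₗ[ℂ] A := sliceFst H.counit ∘ₗ H.T₂.symm.toLinearMap

lemma antipodeMul_T₂ (u : A ⊗[ℂ] A) : H.antipodeMul (H.T₂ u) = sliceFst H.counit u := by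
  simp [antipodeMul]

/-- Formally `S(a₁ u₁) a₂ u₂ = S(u₁) S(a₁) a₂ u₂ = ε(a) S(u₁) u₂`, obtained here from
multiplicativity of `ε` before `S` exists. -/
lemma antipodeMul_comulLeft (a : A) (u : A ⊗[ℂ] A) :
    H.antipodeMul (H.comulLeft a u) = H.counit a • H.antipodeMul u := by
  obtain ⟨w, rfl⟩ := H.T₂.surjective u
  induction w using TensorProduct.induction_on with
  | zero => simp
  | add t t' h h' => simp only [map_add, smul_add, h, h']
  | tmul p q =>
    rw [comulLeft_T₂, antipodeMul_T₂, antipodeMul_T₂]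
    simp [counit_mul, mul_smul]

lemma antipodeMul_mul (u : A ⊗[ℂ] A) (b : A) : H.antipodeMul u * b =
    H.antipodeMul (TensorProduct.map LinearMap.id (LinearMap.mulRight ℂ b) u) := by
  obtain ⟨w, rfl⟩ := H.T₂.surjective u
  induction w using TensorProduct.induction_on with
  | zero => simp
  | add t t' h h' => simp only [map_add, add_mul, h, h']
  | tmul p q =>
    rw [map_id_mulRight_T₂, antipodeMul_T₂, antipodeMul_T₂]
    simp [smul_mul_assoc]

/-- The antipode `S`. -/
noncomputable def antipode : A →ₗ[ℂ] A :=
  -- `antipodeMul` alone gives `S(a)` only as the map `b ↦ S(a) b`. To get an element of `A`, take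
  -- `e` with `ε(e) = 1` and use `S(e₁ a) e₂ = S(a) S(e₁) e₂ = ε(e) S(a)`.
  H.antipodeMul ∘ₗ H.T₁.toLinearMap ∘ₗ TensorProduct.mk ℂ A A H.exists_counit_eq_one.choose

lemma antipodeMul_T₁_mul (p q b : A) : H.antipodeMul (H.T₁ (p ⊗ₜ q)) * b =
    H.counit p • H.antipodeMul (q ⊗ₜ b) := by
  rw [antipodeMul_mul, ← comulLeft_tmul, antipodeMul_comulLeft]

lemma antipode_mul (a b : A) : H.antipode a * b = H.antipodeMul (a ⊗ₜ b) := by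
  have h := H.antipodeMul_T₁_mul H.exists_counit_eq_one.choose a b
  rw [H.exists_counit_eq_one.choose_spec, one_smul] at h
  exact h

lemma antipodeMul_T₁ (p q : A) : H.antipodeMul (H.T₁ (p ⊗ₜ q)) = H.counit p • H.antipode q :=
  H.nondegenerate.ext_mul_right fun b => by
    rw [antipodeMul_T₁_mul, smul_mul_assoc, antipode_mul]

/-- Every `z` is a value of `antipodeMul`, at `T₂ (e ⊗ z)` with `ε(e) = 1`. Rewriting the argument
through `T₁` puts the value in the range of `S`, by `antipodeMul_T₁`. -/
lemma antipode_surjective : Function.Surjective H.antipode := by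
  intro z
  obtain ⟨e, he⟩ := H.exists_counit_eq_one
  have hz : H.antipodeMul (H.T₂ (e ⊗ₜ z)) = z := by simp [antipodeMul_T₂, he]
  obtain ⟨w, hw⟩ := H.T₁.surjective (H.T₂ (e ⊗ₜ z))
  rw [← hw] at hz
  rw [← LinearMap.mem_range, ← hz]
  clear hz hw
  induction w using TensorProduct.induction_on with
  | zero => simp
  | add t t' h h' => rw [map_add, map_add]; exact add_mem h h'
  | tmul p q => exact ⟨H.counit p • q, by rw [antipodeMul_T₁, map_smul]⟩

/-- `S(p₁) p₂ w = ε(p) w`. -/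
lemma mul'_map_antipode_T₂ (p w : A) :
    LinearMap.mul' ℂ A (TensorProduct.map H.antipode LinearMap.id (H.T₂ (p ⊗ₜ w))) =
      H.counit p • w := by
  have h : LinearMap.mul' ℂ A ∘ₗ TensorProduct.map H.antipode LinearMap.id = H.antipodeMul :=
    TensorProduct.ext' fun a b => by simp [antipode_mul]
  rw [← LinearMap.comp_apply, h, antipodeMul_T₂, sliceFst_tmul]

/-- For `v = r ⊗ s`, the identity `Δ(y) T₂(r ⊗ s) = T₂(y r ⊗ s)` absorbs `r` into the second leg of
`Δ(p)(b ⊗ 1)`, and `Δ(p)(b ⊗ r)` is then read through `T₂`. -/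
lemma map_mulRight_coassoc (p b : A) (v : A ⊗[ℂ] A) :
    TensorProduct.map (LinearMap.mulRight ℂ b) LinearMap.id
      (TensorProduct.map LinearMap.id H.T₂.toLinearMap (TensorProduct.assoc ℂ A A A
        (TensorProduct.map (H.T₂.toLinearMap ∘ₗ TensorProduct.mk ℂ A A p) LinearMap.id v))) =
    TensorProduct.map LinearMap.id (H.comulLeft.flip (H.T₂ v)) (H.T₁ (p ⊗ₜ b)) := by
  induction v using TensorProduct.induction_on with
  | zero => simp
  | add t t' h h' =>
    rw [map_add, map_add, map_add, map_add, h, h', map_add, map_add, TensorProduct.map_add_right,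
      LinearMap.add_apply]
  | tmul r s =>
    have h1 : ∀ u : A ⊗[ℂ] A, TensorProduct.map (LinearMap.mulRight ℂ b) LinearMap.id
        (TensorProduct.map LinearMap.id H.T₂.toLinearMap (TensorProduct.assoc ℂ A A A (u ⊗ₜ s))) =
        TensorProduct.map LinearMap.id (H.T₂.toLinearMap ∘ₗ (TensorProduct.mk ℂ A A).flip s)
          (TensorProduct.map (LinearMap.mulRight ℂ b) LinearMap.id u) := by
      intro u
      induction u using TensorProduct.induction_on with
      | zero => simp
      | add t t' h h' => simp only [map_add, TensorProduct.add_tmul, h, h']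
      | tmul m n => simp
    have h2 : H.comulLeft.flip (H.T₂ (r ⊗ₜ s)) =
        H.T₂.toLinearMap ∘ₗ (TensorProduct.mk ℂ A A).flip s ∘ₗ LinearMap.mulRight ℂ r := by
      ext y; simp [comulLeft_T₂]
    rw [h2, TensorProduct.map_tmul, LinearMap.id_apply, LinearMap.comp_apply,
      TensorProduct.mk_apply, LinearEquiv.coe_coe, h1, ← comulLeft_tmul', comulLeft_tmul,
      ← LinearMap.comp_apply, ← TensorProduct.map_comp]
    rfl

/-- Coassociativity in the form `(Δ ⊗ ι)(Δ(p)(1 ⊗ w)) (1 ⊗ q ⊗ 1) = (ι ⊗ Δ)(Δ(p)) (1 ⊗ q ⊗ w)`. -/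
lemma coassoc_T₂ (p q w : A) :
    TensorProduct.assoc ℂ A A A (TensorProduct.map
      (H.T₂.toLinearMap ∘ₗ (TensorProduct.mk ℂ A A).flip q) LinearMap.id (H.T₂ (p ⊗ₜ w))) =
    TensorProduct.map LinearMap.id H.T₂.toLinearMap (TensorProduct.assoc ℂ A A A
      (TensorProduct.map (H.T₂.toLinearMap ∘ₗ TensorProduct.mk ℂ A A p) LinearMap.id
        (H.T₂.symm (q ⊗ₜ w)))) := by
  -- Multiplying the first leg by `b` introduces `T₁ (p ⊗ b)`, which is the form required by
  -- `coassoc'`.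
  apply H.nondegenerate.ext_map_mulRight_id
  intro b
  rw [map_mulRight_coassoc, LinearEquiv.apply_symm_apply]
  have h1 : ∀ u : A ⊗[ℂ] A, TensorProduct.map (LinearMap.mulRight ℂ b) LinearMap.id
      (TensorProduct.assoc ℂ A A A (TensorProduct.map
        (H.T₂.toLinearMap ∘ₗ (TensorProduct.mk ℂ A A).flip q) LinearMap.id u)) =
      TensorProduct.map LinearMap.id (TensorProduct.map (LinearMap.mulRight ℂ q) LinearMap.id)
        (TensorProduct.assoc ℂ A A A (TensorProduct.map
          (H.T₁.toLinearMap ∘ₗ (TensorProduct.mk ℂ A A).flip b) LinearMap.id u)) := by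
    intro u
    induction u using TensorProduct.induction_on with
    | zero => simp
    | add t t' h h' => simp only [map_add, h, h']
    | tmul m n =>
      have h2 := (H.comulLeft_tmul' m b q).symm.trans (H.comulLeft_tmul m b q)
      have h3 : ∀ t : A ⊗[ℂ] A, TensorProduct.map (LinearMap.mulRight ℂ b) LinearMap.id
          (TensorProduct.assoc ℂ A A A (t ⊗ₜ n)) = TensorProduct.assoc ℂ A A A
          (TensorProduct.map (LinearMap.mulRight ℂ b) LinearMap.id t ⊗ₜ n) := by
        intro t
        induction t using TensorProduct.induction_on with
        | zero => simp
        | add t t' h h' => simp only [map_add, TensorProduct.add_tmul, h, h']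
        | tmul m n => simp
      have h4 : ∀ t : A ⊗[ℂ] A, TensorProduct.map LinearMap.id
          (TensorProduct.map (LinearMap.mulRight ℂ q) LinearMap.id)
          (TensorProduct.assoc ℂ A A A (t ⊗ₜ n)) = TensorProduct.assoc ℂ A A A
          (TensorProduct.map LinearMap.id (LinearMap.mulRight ℂ q) t ⊗ₜ n) := by
        intro t
        induction t using TensorProduct.induction_on with
        | zero => simp
        | add t t' h h' => simp only [map_add, TensorProduct.add_tmul, h, h']
        | tmul m n => simp
      simp only [TensorProduct.map_tmul, LinearMap.comp_apply, LinearMap.flip_apply,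
        TensorProduct.mk_apply, LinearEquiv.coe_coe, LinearMap.id_apply]
      rw [h3, h4, h2]
  rw [h1, coassoc', ← LinearMap.comp_apply, ← TensorProduct.map_comp]
  congr 2
  ext y
  simp [comulLeft_tmul']

/-- The left side is formally `Δ(S(p₁)) Δ(p₂) T₂(v) = Δ(S(p₁) p₂) T₂(v)`, and `S(p₁) p₂` collapses
to `ε(p)`. -/
lemma lift_map_T₂ (p : A) (v : A ⊗[ℂ] A) :
    TensorProduct.lift (H.comulLeft ∘ₗ H.antipode)
      (TensorProduct.map LinearMap.id H.T₂.toLinearMap (TensorProduct.assoc ℂ A A A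
        (TensorProduct.map (H.T₂.toLinearMap ∘ₗ TensorProduct.mk ℂ A A p) LinearMap.id v))) =
      H.counit p • H.T₂ v := by
  induction v using TensorProduct.induction_on with
  | zero => simp
  | add t t' h h' => simp only [map_add, smul_add, h, h']
  | tmul r s =>
    have h1 : ∀ u : A ⊗[ℂ] A, TensorProduct.lift (H.comulLeft ∘ₗ H.antipode)
        (TensorProduct.map LinearMap.id H.T₂.toLinearMap (TensorProduct.assoc ℂ A A A (u ⊗ₜ s))) =
        H.T₂ (LinearMap.mul' ℂ A (TensorProduct.map H.antipode LinearMap.id u) ⊗ₜ s) := by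
      intro u
      induction u using TensorProduct.induction_on with
      | zero => simp
      | add t t' h h' => simp only [map_add, TensorProduct.add_tmul, h, h']
      | tmul m n => simp [comulLeft_T₂]
    have h2 := h1 (H.T₂ (p ⊗ₜ r))
    rw [mul'_map_antipode_T₂, ← TensorProduct.smul_tmul', map_smul] at h2
    exact h2

/-- The antipode reverses the comultiplication: `Δ(S(p₁)) (p₂ q ⊗ 1) = q ⊗ S(p)`. -/
lemma T₁_map_antipode_T₂ (p q : A) :
    H.T₁ (TensorProduct.map H.antipode LinearMap.id (H.T₂ (p ⊗ₜ q))) = q ⊗ₜ H.antipode p := by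
  apply H.nondegenerate.ext_map_id_mulRight
  intro y
  have h1 : ∀ u : A ⊗[ℂ] A, TensorProduct.map LinearMap.id (LinearMap.mulRight ℂ y)
      (H.T₁ (TensorProduct.map H.antipode LinearMap.id u)) =
      TensorProduct.lift (H.comulLeft ∘ₗ H.antipode) (TensorProduct.assoc ℂ A A A (u ⊗ₜ y)) := by
    intro u
    induction u using TensorProduct.induction_on with
    | zero => simp
    | add t t' h h' => simp only [map_add, TensorProduct.add_tmul, h, h']
    | tmul m n => simp [comulLeft_tmul]
  -- After multiplication by `y`, write `p ⊗ y` as `T₂ w`. For `w = p' ⊗ w'` the left side becomes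
  -- `Δ(S(p'₁) p'₂)(q ⊗ w') = ε(p') q ⊗ w'`.
  have h2 : ∀ w, TensorProduct.lift (H.comulLeft ∘ₗ H.antipode)
      (TensorProduct.assoc ℂ A A A (TensorProduct.map
        (H.T₂.toLinearMap ∘ₗ (TensorProduct.mk ℂ A A).flip q) LinearMap.id (H.T₂ w))) =
      q ⊗ₜ H.antipodeMul (H.T₂ w) := by
    intro w
    induction w using TensorProduct.induction_on with
    | zero => simp
    | add t t' h h' => simp only [map_add, TensorProduct.tmul_add, h, h']
    | tmul p w =>
      rw [coassoc_T₂, lift_map_T₂, LinearEquiv.apply_symm_apply, antipodeMul_T₂, sliceFst_tmul,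
        TensorProduct.tmul_smul]
  have h3 := h2 (H.T₂.symm (p ⊗ₜ y))
  rw [LinearEquiv.apply_symm_apply] at h3
  rw [h1]
  refine Eq.trans h3 ?_
  simp [antipode_mul]

/-- `p₁ ⊗ S(p₂ e) b = (1 ⊗ S(e)) (p₁ ⊗ S(p₂) b)`. -/
lemma map_antipode_T₂ (d e b : A) :
    TensorProduct.map LinearMap.id (LinearMap.mulRight ℂ b)
      (TensorProduct.map LinearMap.id H.antipode (H.T₂ (d ⊗ₜ e))) =
    TensorProduct.map LinearMap.id (LinearMap.mulLeft ℂ (H.antipode e))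
      (H.T₂.symm (d ⊗ₜ b)) := by
  have h1 : ∀ u : A ⊗[ℂ] A, TensorProduct.map LinearMap.id (LinearMap.mulRight ℂ b)
      (TensorProduct.map LinearMap.id H.antipode u) =
      TensorProduct.map LinearMap.id H.antipodeMul (TensorProduct.assoc ℂ A A A (u ⊗ₜ b)) := by
    intro u
    induction u using TensorProduct.induction_on with
    | zero => simp
    | add t t' h h' => simp only [map_add, TensorProduct.add_tmul, h, h']
    | tmul m n => simp [antipode_mul]
  -- For `v = r ⊗ s`, `antipodeMul` undoes the last `T₂` up to `ε`, leaving `p₁ ε(p₂ r) ⊗ s = ε(r) p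
  -- ⊗ s`.
  have h2 : ∀ p v, TensorProduct.map LinearMap.id H.antipodeMul
      (TensorProduct.map LinearMap.id H.T₂.toLinearMap (TensorProduct.assoc ℂ A A A
        (TensorProduct.map (H.T₂.toLinearMap ∘ₗ TensorProduct.mk ℂ A A p) LinearMap.id v))) =
      p ⊗ₜ[ℂ] sliceFst H.counit v := by
    intro p v
    induction v using TensorProduct.induction_on with
    | zero => simp
    | add t t' h h' => simp only [map_add, TensorProduct.tmul_add, h, h']
    | tmul r s =>
      have h3 : ∀ u : A ⊗[ℂ] A, TensorProduct.map LinearMap.id H.antipodeMul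
          (TensorProduct.map LinearMap.id H.T₂.toLinearMap
            (TensorProduct.assoc ℂ A A A (u ⊗ₜ s))) = sliceSnd H.counit u ⊗ₜ s := by
        intro u
        induction u using TensorProduct.induction_on with
        | zero => simp
        | add t t' h h' => simp only [map_add, TensorProduct.add_tmul, h, h']
        | tmul m n => simp [antipodeMul_T₂, TensorProduct.smul_tmul]
      have h4 := h3 (H.T₂ (p ⊗ₜ r))
      rw [sliceSnd_counit_T₂, TensorProduct.smul_tmul] at h4
      simpa using h4
  have h5 : ∀ w, TensorProduct.map LinearMap.id H.antipodeMul
      (TensorProduct.assoc ℂ A A A (TensorProduct.map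
        (H.T₂.toLinearMap ∘ₗ (TensorProduct.mk ℂ A A).flip e) LinearMap.id (H.T₂ w))) =
      TensorProduct.map LinearMap.id (LinearMap.mulLeft ℂ (H.antipode e)) w := by
    intro w
    induction w using TensorProduct.induction_on with
    | zero => simp
    | add t t' h h' => simp only [map_add, h, h']
    | tmul p w =>
      rw [coassoc_T₂, h2, ← antipodeMul_T₂, LinearEquiv.apply_symm_apply, ← antipode_mul]
      rfl
  have h6 := h5 (H.T₂.symm (d ⊗ₜ b))
  rw [LinearEquiv.apply_symm_apply] at h6
  rw [h1]
  exact h6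

/-! ### The right Haar functional -/

/-- The right invariant functional `ψ = φ ∘ S`. -/
noncomputable def rightHaar : Module.Dual ℂ A := H.haar ∘ₗ H.antipode

/-- Right invariance of `ψ`: slice `T₁_map_antipode_T₂` by `φ` in the second leg and use left
invariance of `φ` at `S(p₁)`. -/
lemma sliceFst_rightHaar_T₂ (p q : A) :
    sliceFst H.rightHaar (H.T₂ (p ⊗ₜ q)) = H.rightHaar p • q := by
  have h : ∀ u : A ⊗[ℂ] A, sliceSnd H.haar (H.T₁ (TensorProduct.map H.antipode LinearMap.id u)) =
      sliceFst H.rightHaar u := by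
    intro u
    induction u using TensorProduct.induction_on with
    | zero => simp
    | add t t' h h' => simp only [map_add, h, h']
    | tmul m n => simp [(H.haar_leftInvariant _ _).1, rightHaar]
  rw [← h, T₁_map_antipode_T₂, sliceSnd_tmul]
  rfl

lemma exists_rightHaar_eq_one : ∃ d, H.rightHaar d = 1 := by
  obtain ⟨d, hd⟩ := H.exists_haar_eq_one
  obtain ⟨e, rfl⟩ := H.antipode_surjective d
  exact ⟨e, hd⟩

/-- Both sides are `(ψ ⊗ φ)(Δ(y) u)`. -/
lemma haar_mul_eq_rightHaar_mul (y : A) (u : A ⊗[ℂ] A) :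
    H.haar (y * sliceSnd H.rightHaar (H.T₁.symm u)) =
      H.rightHaar (y * sliceSnd H.haar (H.T₂.symm u)) := by
  have h1 : ∀ v, H.rightHaar (sliceSnd H.haar (H.comulLeft y (H.T₁ v))) =
      H.haar (y * sliceSnd H.rightHaar v) := by
    intro v
    induction v using TensorProduct.induction_on with
    | zero => simp
    | add t t' h h' => simp only [map_add, mul_add, h, h']
    | tmul p q => simp [comulLeft_T₁, (H.haar_leftInvariant _ _).1, mul_smul_comm, mul_comm]
  have h2 : ∀ v, H.rightHaar (sliceSnd H.haar (H.comulLeft y (H.T₂ v))) =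
      H.rightHaar (y * sliceSnd H.haar v) := by
    intro v
    rw [apply_sliceSnd]
    induction v using TensorProduct.induction_on with
    | zero => simp
    | add t t' h h' => simp only [map_add, mul_add, h, h']
    | tmul p q => simp [comulLeft_T₂, sliceFst_rightHaar_T₂, mul_smul_comm, mul_comm]
  rw [← h1, ← h2, LinearEquiv.apply_symm_apply, LinearEquiv.apply_symm_apply]

/-- The space `Â` can be described by the right Haar functional. -/
lemma mem_dual_iff_rightHaar {ω : Module.Dual ℂ A} :
    ω ∈ H.dual ↔ ∃ a, ∀ x, ω x = H.rightHaar (x * a) := by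
  rw [mem_dual]
  constructor
  · rintro ⟨a, ha⟩
    obtain ⟨d, hd⟩ := H.exists_rightHaar_eq_one
    -- With `u = T₁ (a ⊗ d)` and `ψ(d) = 1`, the other side of `haar_mul_eq_rightHaar_mul` is `φ(x
    -- a)`. The converse exchanges the roles of `φ` and `ψ`.
    refine ⟨sliceSnd H.haar (H.T₂.symm (H.T₁ (a ⊗ₜ d))), fun x => ?_⟩
    rw [ha, ← haar_mul_eq_rightHaar_mul]
    simp [hd]
  · rintro ⟨a, ha⟩
    obtain ⟨d, hd⟩ := H.exists_haar_eq_one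
    refine ⟨sliceSnd H.rightHaar (H.T₁.symm (H.T₂ (a ⊗ₜ d))), fun x => ?_⟩
    rw [ha, haar_mul_eq_rightHaar_mul]
    simp [hd]

/-! ### The dual algebra -/

/-- The map `a ↦ a φ` from `A` onto `Â`. -/
noncomputable def toDual : A →ₗ[ℂ] H.dual := ((actFunctional A).flip H.haar).rangeRestrict

lemma toDual_apply (a x : A) : (H.toDual a).1 x = H.haar (x * a) := rfl

lemma toDual_surjective : Function.Surjective H.toDual := LinearMap.surjective_rangeRestrict _

/-- The map `a ↦ a ψ` from `A` onto `Â`. -/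
noncomputable def toDualRight : A →ₗ[ℂ] H.dual :=
  ((actFunctional A).flip H.rightHaar).codRestrict H.dual
    fun a => H.mem_dual_iff_rightHaar.2 ⟨a, fun _ => rfl⟩

lemma toDualRight_apply (a x : A) : (H.toDualRight a).1 x = H.rightHaar (x * a) := rfl

lemma toDualRight_surjective : Function.Surjective H.toDualRight := by
  intro ω
  obtain ⟨a, ha⟩ := H.mem_dual_iff_rightHaar.1 ω.2
  exact ⟨a, Subtype.ext (LinearMap.ext fun x => (ha x).symm)⟩

lemma slice_toDual (a x : A) : H.slice (H.toDual a) x = sliceSnd H.haar (H.T₂ (x ⊗ₜ a)) :=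
  H.slice_eq (fun _ => rfl) x

lemma toDual_apply_slice (a x : A) (ω : H.dual) :
    (H.toDual a).1 (H.slice ω x) = ω.1 (sliceFst H.haar (H.T₁ (x ⊗ₜ a))) := by
  rw [toDual_apply, slice_mul, apply_sliceSnd]

/-- Products in `Â` evaluate `ω` on slices of `T₂` (factor on the right) or of `T₁` (factor on the
left) by `φ`. These bijections are onto and `φ ≠ 0`, so the slices fill `A`. -/
lemma dual_nondegenerate : IsNondegenerate H.dual := by
  obtain ⟨d, hd⟩ := H.exists_haar_eq_one
  constructor
  · intro ω h
    refine Subtype.ext (LinearMap.ext fun x => ?_)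
    have hu : ∀ u, ω.1 (sliceSnd H.haar (H.T₂ u)) = 0 := by
      intro u
      induction u using TensorProduct.induction_on with
      | zero => simp
      | add t t' h h' => rw [map_add, map_add, map_add, h, h', add_zero]
      | tmul y a =>
        rw [← slice_toDual, ← dual_mul_apply, h]
        rfl
    simpa [hd] using hu (H.T₂.symm (x ⊗ₜ d))
  · intro ω h
    refine Subtype.ext (LinearMap.ext fun x => ?_)
    have hu : ∀ u, ω.1 (sliceFst H.haar (H.T₁ u)) = 0 := by
      intro u
      induction u using TensorProduct.induction_on with
      | zero => simp
      | add t t' h h' => rw [map_add, map_add, map_add, h, h', add_zero]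
      | tmul y a =>
        rw [← toDual_apply_slice, ← dual_mul_apply, h]
        rfl
    simpa [hd] using hu (H.T₁.symm (d ⊗ₜ x))

/-- At `x`, both sides are `(φ ⊗ φ)(Δ(x)(a ⊗ b))`. The formula shows that products span `Â`, which
makes the extension of `Δ ⊗ ι` to `M(A ⊗ Â)` well defined. -/
lemma toDual_mul_toDual (a b : A) : H.toDual a * H.toDual b =
    H.toDual (sliceSnd H.haar (H.T₁.symm (a ⊗ₜ b))) := by
  refine Subtype.ext (LinearMap.ext fun x => ?_)
  rw [dual_mul_apply, toDual_apply_slice, toDual_apply, toDual_apply]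
  have h1 : sliceFst H.haar (H.T₁ (x ⊗ₜ a)) * b = sliceFst H.haar (H.comulLeft x (a ⊗ₜ b)) := by
    rw [comulLeft_tmul, sliceFst_map_id_mulRight]
  have h2 : ∀ v, H.haar (sliceFst H.haar (H.comulLeft x (H.T₁ v))) =
      H.haar (x * sliceSnd H.haar v) := by
    intro v
    rw [← apply_sliceSnd]
    induction v using TensorProduct.induction_on with
    | zero => simp
    | add t t' h h' => simp only [map_add, mul_add, h, h']
    | tmul p q => simp [comulLeft_T₁, (H.haar_leftInvariant _ _).1, mul_smul_comm, mul_comm]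
  rw [h1, ← h2, LinearEquiv.apply_symm_apply]

lemma isNondegenerateHom_incl_dual : IsNondegenerateHom (incl H.dual) := by
  have h : Submodule.span ℂ {z : H.dual | ∃ x y, z = x * y} = ⊤ := by
    rw [← top_le_iff]
    intro ω _
    obtain ⟨a, rfl⟩ := H.toDual_surjective ω
    obtain ⟨d, hd⟩ := H.exists_haar_eq_one
    have hu : ∀ u, H.toDual (sliceSnd H.haar (H.T₁.symm u)) ∈
        Submodule.span ℂ {z : H.dual | ∃ x y, z = x * y} := by
      intro u
      induction u using TensorProduct.induction_on with
      | zero => simp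
      | add t t' h h' => rw [map_add, map_add, map_add]; exact add_mem h h'
      | tmul y a =>
        rw [← toDual_mul_toDual]
        exact Submodule.subset_span ⟨_, _, rfl⟩
    simpa [hd] using hu (H.T₁ (a ⊗ₜ d))
  refine ⟨h, ?_⟩
  rw [← h]
  congr 1
  ext z
  exact exists_comm

/-! ### Elements of `A ⊗ Â` as operators -/

lemma toOperator_tmul (x : A) (ω : H.dual) (y : A) : H.toOperator (x ⊗ₜ ω) y = ω.1 y • x := rfl

/-- Evaluation of functionals in `Â` at `y`. -/
noncomputable def evalDual (y : A) : Module.Dual ℂ H.dual :=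
  (Module.Dual.eval ℂ A y) ∘ₗ H.dual.subtype

lemma evalDual_apply (y : A) (ω : H.dual) : H.evalDual y ω = ω.1 y := rfl

lemma toOperator_eq (t : A ⊗[ℂ] H.dual) (y : A) :
    H.toOperator t y = sliceSnd (H.evalDual y) t := by
  induction t using TensorProduct.induction_on with
  | zero => simp
  | add t t' h h' => simp [h, h']
  | tmul x ω => simp [toOperator_tmul, evalDual_apply]

lemma toOperator_injective : Function.Injective H.toOperator := by
  rw [← LinearMap.ker_eq_bot, LinearMap.ker_eq_bot']
  intro t ht
  refine eq_zero_of_sliceFst fun χ => Subtype.ext (LinearMap.ext fun y => ?_)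
  change H.evalDual y (sliceFst χ t) = 0
  rw [← apply_sliceSnd, ← toOperator_eq, ht]
  simp

/-- The operator `[U t](y)`, which is `(ι ⊗ ω)(Δ(y)(x ⊗ 1))` for `t = x ⊗ ω`. -/
noncomputable def leftOperator : A ⊗[ℂ] H.dual →ₗ[ℂ] A →ₗ[ℂ] A :=
  TensorProduct.lift (LinearMap.mk₂ ℂ (fun x ω => LinearMap.mulRight ℂ x ∘ₗ H.slice ω)
    (fun x x' ω => by ext y; simp [mul_add]) (fun c x ω => by ext y; simp [mul_smul_comm])
    (fun x ω ω' => by ext y; simp [slice_add, add_mul])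
    (fun c x ω => by ext y; simp [slice_smul]))

lemma leftOperator_tmul (x : A) (ω : H.dual) (y : A) :
    H.leftOperator (x ⊗ₜ ω) y = H.slice ω y * x := rfl

/-- The operator `[t U](y)`, which is `(ω ⊗ ι)((1 ⊗ x)Δ(y))` for `t = x ⊗ ω`. -/
noncomputable def rightOperator : A ⊗[ℂ] H.dual →ₗ[ℂ] A →ₗ[ℂ] A :=
  TensorProduct.lift (LinearMap.mk₂ ℂ
    (fun x ω => sliceFst ω.1 ∘ₗ H.T₄.toLinearMap ∘ₗ (TensorProduct.mk ℂ A A).flip x)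
    (fun x x' ω => by ext y; simp)
    (fun c x ω => by ext y; simp)
    (fun x ω ω' => by ext y; simp [sliceFst_add]) (fun c x ω => by ext y; simp [sliceFst_smul]))

lemma rightOperator_tmul (x : A) (ω : H.dual) (y : A) :
    H.rightOperator (x ⊗ₜ ω) y = sliceFst ω.1 (H.T₄ (y ⊗ₜ x)) := rfl

/-- The rigorous form of `(U t)(y) = y₁ t(y₂)`, covered by `b` on the left; `rightOperator_mul` does
the same for `(t U)(y) = t(y₁) y₂`. -/
lemma mul_leftOperator (t : A ⊗[ℂ] H.dual) (b y : A) : b * H.leftOperator t y =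
    LinearMap.mul' ℂ A (TensorProduct.map LinearMap.id (H.toOperator t) (H.T₃ (y ⊗ₜ b))) := by
  induction t using TensorProduct.induction_on with
  | zero => simp
  | add t t' h h' => simp [mul_add, h, h', TensorProduct.map_add_right]
  | tmul x ω =>
    rw [leftOperator_tmul, slice_mul]
    have h1 : b * sliceSnd ω.1 (H.T₁ (y ⊗ₜ x)) = sliceSnd ω.1 (H.T₃ (y ⊗ₜ b)) * x := by
      rw [← sliceSnd_map_mulRight_id, ← map_mulLeft_T₁, sliceSnd_map_mulLeft]
    rw [h1]
    generalize H.T₃ (y ⊗ₜ b) = u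
    induction u using TensorProduct.induction_on with
    | zero => simp
    | add t t' h h' => simp only [map_add, add_mul, h, h']
    | tmul p q => simp [toOperator_tmul, smul_mul_assoc]

lemma rightOperator_mul (t : A ⊗[ℂ] H.dual) (b y : A) : H.rightOperator t y * b =
    LinearMap.mul' ℂ A (TensorProduct.map (H.toOperator t) LinearMap.id (H.T₂ (y ⊗ₜ b))) := by
  induction t using TensorProduct.induction_on with
  | zero => simp
  | add t t' h h' => simp [add_mul, h, h', TensorProduct.map_add_left]
  | tmul x ω =>
    rw [rightOperator_tmul, ← sliceFst_map_id_mulRight, ← map_id_mulLeft_T₂,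
      sliceFst_map_id_mulLeft]
    generalize H.T₂ (y ⊗ₜ b) = u
    induction u using TensorProduct.induction_on with
    | zero => simp
    | add t t' h h' => simp only [map_add, mul_add, h, h']
    | tmul p q => simp [toOperator_tmul, smul_mul_assoc, mul_smul_comm]

/-! ### Multiplication by `U` on either side is a bijection of `A ⊗ Â`. -/

lemma leftOperator_injective : Function.Injective H.leftOperator := by
  rw [← LinearMap.ker_eq_bot, LinearMap.ker_eq_bot']
  intro t ht
  have hu : ∀ u, LinearMap.mul' ℂ A
      (TensorProduct.map LinearMap.id (H.toOperator t) (H.T₃ u)) = 0 := by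
    intro u
    induction u using TensorProduct.induction_on with
    | zero => simp
    | add t t' h h' => simp only [map_add, h, h', add_zero]
    | tmul y b => rw [← mul_leftOperator, ht]; simp
  apply H.toOperator_injective
  rw [map_zero]
  refine LinearMap.ext fun z => H.nondegenerate.eq_zero_of_mul_left _ fun b => ?_
  -- Surjectivity of `T₃` replaces `b y₁ ⊗ y₂` by an arbitrary `b ⊗ z`, so `b t(z) = 0`.
  simpa using hu (H.T₃.symm (b ⊗ₜ z))

lemma rightOperator_injective : Function.Injective H.rightOperator := by
  rw [← LinearMap.ker_eq_bot, LinearMap.ker_eq_bot']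
  intro t ht
  have hu : ∀ u, LinearMap.mul' ℂ A
      (TensorProduct.map (H.toOperator t) LinearMap.id (H.T₂ u)) = 0 := by
    intro u
    induction u using TensorProduct.induction_on with
    | zero => simp
    | add t t' h h' => simp only [map_add, h, h', add_zero]
    | tmul y b => rw [← rightOperator_mul, ht]; simp
  apply H.toOperator_injective
  rw [map_zero]
  refine LinearMap.ext fun z => H.nondegenerate.eq_zero_of_mul_right _ fun b => ?_
  simpa using hu (H.T₂.symm (z ⊗ₜ b))

lemma range_leftOperator : LinearMap.range H.leftOperator = LinearMap.range H.toOperator := by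
  have hs := TensorProduct.map_surjective (g := (LinearMap.id : A →ₗ[ℂ] A)) Function.surjective_id
    H.toDual_surjective
  -- The underlying identity is `U · (ι ⊗ toDual)(T₁(p ⊗ q)) = q ⊗ p φ`: at `y`, left invariance
  -- gives `(ι ⊗ φ)(T₁(y p ⊗ q)) = φ(y p) q`.
  refine range_eq_of_comp_surjective
    (p := TensorProduct.map LinearMap.id H.toDual ∘ₗ H.T₁.toLinearMap)
    (q := TensorProduct.map LinearMap.id H.toDual ∘ₗ (TensorProduct.comm ℂ A A).toLinearMap)
    (hs.comp H.T₁.surjective) (hs.comp (TensorProduct.comm ℂ A A).surjective) fun v => ?_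
  ext y
  have h1 : ∀ u, H.leftOperator (TensorProduct.map LinearMap.id H.toDual u) y =
      sliceSnd H.haar (H.comulLeft y u) := by
    intro u
    induction u using TensorProduct.induction_on with
    | zero => simp
    | add t t' h h' => simp only [map_add, LinearMap.add_apply, h, h']
    | tmul p q =>
      rw [TensorProduct.map_tmul, leftOperator_tmul, slice_toDual, LinearMap.id_apply,
        comulLeft_tmul', sliceSnd_map_mulRight_id]
  rw [LinearMap.comp_apply, LinearMap.comp_apply, h1]
  induction v using TensorProduct.induction_on with
  | zero => simp
  | add t t' h h' => simp only [map_add, LinearMap.add_apply, h, h']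
  | tmul p q =>
    simp [comulLeft_T₁, (H.haar_leftInvariant _ _).1, toOperator_tmul, toDual_apply]

/-- The map `d ⊗ x ↦ x ⊗ d ψ`. -/
noncomputable def flipDualRight : A ⊗[ℂ] A →ₗ[ℂ] A ⊗[ℂ] H.dual :=
  TensorProduct.map LinearMap.id H.toDualRight ∘ₗ (TensorProduct.comm ℂ A A).toLinearMap

lemma flipDualRight_tmul (d x : A) : H.flipDualRight (d ⊗ₜ x) = x ⊗ₜ H.toDualRight d := rfl

lemma flipDualRight_surjective : Function.Surjective H.flipDualRight :=
  (TensorProduct.map_surjective Function.surjective_id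
    H.toDualRight_surjective).comp (TensorProduct.comm ℂ A A).surjective

lemma toOperator_flipDualRight (u : A ⊗[ℂ] A) (y : A) : H.toOperator (H.flipDualRight u) y =
    sliceFst (H.rightHaar ∘ₗ LinearMap.mulLeft ℂ y) u := by
  induction u using TensorProduct.induction_on with
  | zero => simp
  | add t t' h h' => simp only [map_add, LinearMap.add_apply, h, h']
  | tmul p q => simp [flipDualRight_tmul, toOperator_tmul, toDualRight_apply]

lemma sliceFst_rightHaar_comulLeft_T₂ (y : A) (w : A ⊗[ℂ] A) :
    sliceFst H.rightHaar (H.comulLeft y (H.T₂ w)) =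
      sliceFst (H.rightHaar ∘ₗ LinearMap.mulLeft ℂ y) w := by
  induction w using TensorProduct.induction_on with
  | zero => simp
  | add t t' h h' => simp only [map_add, h, h']
  | tmul p q => simp [comulLeft_T₂, sliceFst_rightHaar_T₂]

lemma range_rightOperator : LinearMap.range H.rightOperator = LinearMap.range H.toOperator := by
  have hs := TensorProduct.map_surjective (g := (LinearMap.id : A →ₗ[ℂ] A)) Function.surjective_id
    H.antipode_surjective
  -- The underlying identity is `(S(e) ⊗ d ψ) U = S(d₂ e) ⊗ d₁ ψ`. It rests on `ψ(y d₁) S(d₂) = ψ(y₁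
  -- d) y₂`, a consequence of right invariance. Surjectivity of `S` ensures that all elements are
  -- reached.
  refine range_eq_of_comp_surjective
    (p := H.flipDualRight ∘ₗ TensorProduct.map LinearMap.id H.antipode)
    (q := H.flipDualRight ∘ₗ TensorProduct.map LinearMap.id H.antipode ∘ₗ H.T₂.toLinearMap)
    (H.flipDualRight_surjective.comp hs)
    (H.flipDualRight_surjective.comp (hs.comp H.T₂.surjective)) fun v => ?_
  induction v using TensorProduct.induction_on with
  | zero => simp
  | add t t' h h' => simp only [map_add, h, h']
  | tmul d e =>
    refine LinearMap.ext fun y => H.nondegenerate.ext_mul_right fun b => ?_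
    simp only [LinearMap.comp_apply, LinearEquiv.coe_coe]
    rw [toOperator_flipDualRight, ← sliceFst_map_id_mulRight, map_antipode_T₂,
      sliceFst_map_id_mulLeft, ← sliceFst_rightHaar_comulLeft_T₂, LinearEquiv.apply_symm_apply,
      TensorProduct.map_tmul, flipDualRight_tmul, rightOperator_tmul, ← sliceFst_map_id_mulRight,
      LinearMap.id_apply, ← map_id_mulLeft_T₂, sliceFst_map_id_mulLeft, comulLeft_tmul',
      sliceFst_map_fst]
    rfl

/-! ### The universal corepresentation -/

/-- The convolution formula `(t s)(y) = t(y₁) s(y₂)` for `s = x ⊗ ω`. -/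
lemma toOperator_mul_tmul (t : A ⊗[ℂ] H.dual) (x : A) (ω : H.dual) (y : A) :
    H.toOperator (t * (x ⊗ₜ ω)) y = H.toOperator t (H.slice ω y) * x := by
  induction t using TensorProduct.induction_on with
  | zero => simp
  | add t t' h h' => simp only [map_add, add_mul, LinearMap.add_apply, h, h']
  | tmul p η =>
    simp [toOperator_tmul, dual_mul_apply, smul_mul_assoc]

lemma toOperator_tmul_toDual_mul (x c : A) (s : A ⊗[ℂ] H.dual) (y : A) :
    H.toOperator ((x ⊗ₜ H.toDual c) * s) y =
      x * sliceFst H.haar (TensorProduct.map LinearMap.id (H.toOperator s) (H.T₁ (y ⊗ₜ c))) := by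
  induction s using TensorProduct.induction_on with
  | zero => simp
  | add t t' h h' =>
    simp only [map_add, mul_add, LinearMap.add_apply, h, h', TensorProduct.map_add_right]
  | tmul p η =>
    rw [toOperator_mul_tmul, toOperator_tmul, toDual_apply_slice, smul_mul_assoc, ← mul_smul_comm]
    congr 1
    generalize H.T₁ (y ⊗ₜ c) = u
    induction u using TensorProduct.induction_on with
    | zero => simp
    | add t t' h h' => simp only [map_add, add_smul, h, h']
    | tmul m n => simp [toOperator_tmul, mul_smul, smul_comm (H.haar m)]

/-- Both sides are the operator `y ↦ s(y₁) y₂ t(y₃)`. The legs are matched by `T₁_slice`, which is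
coassociativity; writing `ω = c φ` supplies the `c` that covers `Δ(y)`. -/
lemma mul_eq_mul_of_toOperator {L R : A ⊗[ℂ] H.dual →ₗ[ℂ] A ⊗[ℂ] H.dual}
    (hL : ∀ t, H.toOperator (L t) = H.leftOperator t)
    (hR : ∀ t, H.toOperator (R t) = H.rightOperator t) (s t : A ⊗[ℂ] H.dual) :
    s * L t = R s * t := by
  induction s using TensorProduct.induction_on with
  | zero => simp
  | add t t' h h' => simp only [map_add, add_mul, h, h']
  | tmul x ω =>
    induction t using TensorProduct.induction_on with
    | zero => simp
    | add t t' h h' => simp only [map_add, mul_add, h, h']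
    | tmul x' ω' =>
      obtain ⟨c, rfl⟩ := H.toDual_surjective ω
      apply H.toOperator_injective
      ext y
      rw [toOperator_mul_tmul, hR, toOperator_tmul_toDual_mul, hL, rightOperator_tmul]
      have h1 : H.leftOperator (x' ⊗ₜ ω') = LinearMap.mulRight ℂ x' ∘ₗ H.slice ω' := rfl
      have h2 : (H.toDual c).1 = H.haar ∘ₗ LinearMap.mulRight ℂ c := rfl
      rw [h1, h2, ← sliceFst_map_fst, ← map_id_mulLeft_T₁, sliceFst_map_id_mulLeft, mul_assoc,
        ← LinearMap.id_comp (LinearMap.id : A →ₗ[ℂ] A), TensorProduct.map_comp,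
        LinearMap.comp_apply, ← T₁_slice, sliceFst_map_id_mulRight]

lemma isUniversal_iff (U : Mult (A ⊗[ℂ] H.dual)) : H.IsUniversal U ↔
    (∀ t, H.toOperator (U.lmul t) = H.leftOperator t) ∧
      ∀ t, H.toOperator (U.rmul t) = H.rightOperator t := by
  constructor
  · intro h
    constructor
    · intro t
      refine LinearMap.congr_fun (f := H.toOperator ∘ₗ U.lmul)
        (TensorProduct.ext' fun x ω => LinearMap.ext fun y => ?_) t
      rw [leftOperator_tmul, slice_mul]
      exact (h x ω y).1
    · intro t
      exact LinearMap.congr_fun (f := H.toOperator ∘ₗ U.rmul)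
        (TensorProduct.ext' fun x ω => LinearMap.ext fun y => (h x ω y).2) t
  · rintro ⟨hl, hr⟩ x ω y
    rw [hl, hr, leftOperator_tmul, slice_mul]
    exact ⟨rfl, rfl⟩

lemma exists_isUniversal_isUnit : ∃ U : Mult (A ⊗[ℂ] H.dual), H.IsUniversal U ∧ IsUnit U := by
  obtain ⟨L, hL⟩ := exists_linearEquiv_of_range_eq H.leftOperator_injective
    H.toOperator_injective H.range_leftOperator
  obtain ⟨R, hR⟩ := exists_linearEquiv_of_range_eq H.rightOperator_injective
    H.toOperator_injective H.range_rightOperator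
  obtain ⟨U, hl, hr⟩ := (H.nondegenerate.tensor H.dual_nondegenerate).exists_mult
    L.toLinearMap R.toLinearMap (H.mul_eq_mul_of_toOperator hL hR)
  refine ⟨U, (H.isUniversal_iff U).2 ⟨?_, ?_⟩, U.isUnit_of_bijective ?_ ?_⟩
  · rw [hl]; exact hL
  · rw [hr]; exact hR
  · rw [hl]; exact L.bijective
  · rw [hr]; exact R.bijective

/-! ### Uniqueness, slices and the corepresentation identity. -/

variable {H}

lemma IsUniversal.eq {U V : Mult (A ⊗[ℂ] H.dual)} (hU : H.IsUniversal U) (hV : H.IsUniversal V) :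
    U = V := by
  rw [isUniversal_iff] at hU hV
  exact Mult.ext (fun t => H.toOperator_injective (by rw [hU.1, hV.1]))
    (fun t => H.toOperator_injective (by rw [hU.2, hV.2]))

/-- At `y`, the slice of `U (a ⊗ η)` by `χ` is `(a χ)((ι ⊗ η)Δ(y))`. Summing over any decomposition
of `ω` gives `(ω η)(y)`, whatever the decomposition. -/
lemma IsUniversal.isLeftSlice {U : Mult (A ⊗[ℂ] H.dual)} (hU : H.IsUniversal U) (ω : H.dual) :
    IsLeftSlice U ω.1 (incl H.dual ω).lmul := by
  intro n a χ h η
  refine Subtype.ext (LinearMap.ext fun y => ?_)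
  have h1 : ∀ i, H.evalDual y (sliceFst (χ i) (U.lmul (a i ⊗ₜ η))) =
      χ i (H.slice η y * a i) := by
    intro i
    rw [← apply_sliceSnd, ← toOperator_eq, ((H.isUniversal_iff U).1 hU).1, leftOperator_tmul]
  rw [incl_lmul, dual_mul_apply, h]
  change _ = H.evalDual y _
  simp [h1]

lemma IsUniversal.rep_eq {U : Mult (A ⊗[ℂ] H.dual)} (hU : H.IsUniversal U) (ω : H.dual) :
    H.rep U ω = incl H.dual ω := by
  have h : ∃ m : Mult H.dual, IsLeftSlice U ω.1 m.lmul := ⟨_, hU.isLeftSlice ω⟩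
  rw [rep, dif_pos h]
  obtain ⟨a, ha⟩ := mem_dual.1 ω.2
  -- `IsLeftSlice` pins down a map only when the functional has some decomposition; `ω = a φ` is one
  -- with a single term, so the chosen multiplier must be `ω`.
  have hω : ω.1 = ∑ i : Fin 1, actFunctional A ((fun _ => a) i) ((fun _ => H.haar) i) :=
    LinearMap.ext fun x => by simp [ha]
  refine Mult.ext_left H.dual_nondegenerate fun η => ?_
  rw [h.choose_spec 1 _ _ hω, hU.isLeftSlice ω 1 _ _ hω]

/-- Elements of `A ⊗ A ⊗ Â` are determined by their values as operators `A → A ⊗ A`. -/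
lemma ext_map_toOperator {s t : A ⊗[ℂ] (A ⊗[ℂ] H.dual)}
    (h : ∀ y, TensorProduct.map LinearMap.id (H.toOperator.flip y) s =
      TensorProduct.map LinearMap.id (H.toOperator.flip y) t) : s = t := by
  refine sub_eq_zero.1 (eq_zero_of_sliceFst fun χ => H.toOperator_injective ?_)
  have h1 : ∀ (u : A ⊗[ℂ] (A ⊗[ℂ] H.dual)) y, H.toOperator (sliceFst χ u) y =
      sliceFst χ (TensorProduct.map LinearMap.id (H.toOperator.flip y) u) := by
    intro u y
    induction u using TensorProduct.induction_on with
    | zero => simp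
    | add t t' h h' => simp only [map_add, LinearMap.add_apply, h, h']
    | tmul p q => simp
  ext y
  rw [h1, map_sub, h, sub_self, map_zero]
  simp

/-- `U₁₃ U₂₃ (g ⊗ θ)` is the operator `y ↦ Δ((ι ⊗ θ)Δ(y)) g`. -/
lemma IsUniversal.map_toOperator_leg {U : Mult (A ⊗[ℂ] H.dual)} (hU : H.IsUniversal U)
    (g : A ⊗[ℂ] A) (θ : H.dual) (y : A) :
    TensorProduct.map LinearMap.id (H.toOperator.flip y)
      ((leg₁₃ U * leg₂₃ U).lmul (TensorProduct.assoc ℂ A A H.dual (g ⊗ₜ θ))) =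
      H.comulLeft (H.slice θ y) g := by
  obtain ⟨hU, -⟩ := (H.isUniversal_iff U).1 hU
  induction g using TensorProduct.induction_on with
  | zero => simp
  | add t t' h h' => simp only [map_add, TensorProduct.add_tmul, h, h']
  | tmul a b =>
    -- `U₁₃ (a ⊗ s)` is the operator `y ↦ y₁ a ⊗ s(y₂)`. Taking `s = U (b ⊗ θ)` then gives `y₁ a ⊗
    -- y₂ b θ(y₃)`.
    have h1 : ∀ s : A ⊗[ℂ] H.dual, TensorProduct.map LinearMap.id (H.toOperator.flip y)
        ((leg₁₃ U).lmul (a ⊗ₜ s)) =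
        TensorProduct.map LinearMap.id (H.toOperator s) (H.T₁ (y ⊗ₜ a)) := by
      intro s
      induction s using TensorProduct.induction_on with
      | zero => simp
      | add t t' h h' =>
        simp only [map_add, TensorProduct.tmul_add, h, h', TensorProduct.map_add_right,
          LinearMap.add_apply]
      | tmul p η =>
        have h2 : ∀ v : A ⊗[ℂ] H.dual, TensorProduct.map LinearMap.id (H.toOperator.flip y)
            ((TensorProduct.leftComm ℂ A A H.dual) (p ⊗ₜ v)) = H.toOperator v y ⊗ₜ p := by
          intro v
          induction v using TensorProduct.induction_on with
          | zero => simp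
          | add t t' h h' =>
            simp only [map_add, LinearMap.add_apply, TensorProduct.tmul_add,
              TensorProduct.add_tmul, h, h']
          | tmul m n => simp [toOperator_tmul, TensorProduct.smul_tmul]
        have h3 : (leg₁₃ U).lmul (a ⊗ₜ (p ⊗ₜ η)) =
            TensorProduct.leftComm ℂ A A H.dual (p ⊗ₜ U.lmul (a ⊗ₜ η)) := by
          simp [leg₁₃]
        rw [h3, h2, hU, leftOperator_tmul, slice_mul]
        generalize H.T₁ (y ⊗ₜ a) = u
        induction u using TensorProduct.induction_on with
        | zero => simp
        | add t t' h h' => simp only [map_add, TensorProduct.add_tmul, h, h']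
        | tmul m n => simp [toOperator_tmul, TensorProduct.smul_tmul]
    have h4 : (leg₂₃ U).lmul (a ⊗ₜ (b ⊗ₜ θ)) = a ⊗ₜ U.lmul (b ⊗ₜ θ) := rfl
    have h5 : H.leftOperator (b ⊗ₜ θ) = LinearMap.mulRight ℂ b ∘ₗ H.slice θ := rfl
    rw [TensorProduct.assoc_tmul, mul_lmul_apply, h4, h1, hU, h5, comulLeft_tmul, T₁_slice,
      ← LinearMap.comp_apply, ← TensorProduct.map_comp, LinearMap.id_comp]

lemma IsUniversal.isCorepresentation {U : Mult (A ⊗[ℂ] H.dual)} (hU : H.IsUniversal U) :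
    H.IsCorepresentation U := by
  have hY : IsNondegenerate (A ⊗[ℂ] (A ⊗[ℂ] H.dual)) :=
    H.nondegenerate.tensor (H.nondegenerate.tensor H.dual_nondegenerate)
  have hπ : IsNondegenerateHom (comulTensorId H.dual H.comul) :=
    (H.comul_nondegenerate.tensor H.isNondegenerateHom_incl_dual).congrHom _ _
  -- By non-degeneracy it suffices to compare after multiplication by `(Δ ⊗ ι)(u)`, where the
  -- extension of `Δ ⊗ ι` at `U` becomes `(Δ ⊗ ι)(U u)`.
  refine hπ.ext hY fun u => ?_
  rw [(extend_spec hY hπ U u).1]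
  have h1 : ∀ (x : A) (ω : H.dual) (g : A ⊗[ℂ] A) (η : H.dual),
      (comulTensorId H.dual H.comul (x ⊗ₜ ω)).lmul (TensorProduct.assoc ℂ A A H.dual (g ⊗ₜ η)) =
        TensorProduct.assoc ℂ A A H.dual (H.comulLeft x g ⊗ₜ (ω * η)) := by
    intro x ω g η
    simp [comulTensorId, comulLeft_apply]
  -- `(Δ ⊗ ι)(u)(g ⊗ η)` is the operator `y ↦ Δ(u(z)) g` with `z = (ι ⊗ η)Δ(y)`. With `U u` in place
  -- of `u = x ⊗ ω` this is `Δ((ι ⊗ ω)Δ(z)) Δ(x) g`, which is what `map_toOperator_leg` gives for `θ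
  -- = ω η`.
  have h2 : ∀ (u : A ⊗[ℂ] H.dual) (g : A ⊗[ℂ] A) (η : H.dual) (y : A),
      TensorProduct.map LinearMap.id (H.toOperator.flip y)
        ((comulTensorId H.dual H.comul u).lmul (TensorProduct.assoc ℂ A A H.dual (g ⊗ₜ η))) =
        H.comulLeft (H.toOperator u (H.slice η y)) g := by
    intro u g η y
    induction u using TensorProduct.induction_on with
    | zero => simp
    | add t t' h h' => simp only [map_add, add_lmul, LinearMap.add_apply, h, h']
    | tmul x ω =>
      rw [h1, toOperator_tmul, map_smul, LinearMap.smul_apply]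
      generalize H.comulLeft x g = v
      induction v using TensorProduct.induction_on with
      | zero => simp
      | add t t' h h' => simp only [map_add, smul_add, TensorProduct.add_tmul, h, h']
      | tmul m n => simp [toOperator_tmul, dual_mul_apply]
  refine Mult.ext_left hY fun z => ?_
  obtain ⟨w, rfl⟩ := (TensorProduct.assoc ℂ A A H.dual).surjective z
  rw [mul_lmul_apply]
  induction w using TensorProduct.induction_on with
  | zero => simp
  | add t t' h h' => simp only [map_add, h, h']
  | tmul g η =>
    refine ext_map_toOperator fun y => ?_
    rw [h2]
    induction u using TensorProduct.induction_on with
    | zero => simp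
    | add t t' h h' => simp only [map_add, add_lmul, LinearMap.add_apply, h, h']
    | tmul x ω =>
      rw [h1, hU.map_toOperator_leg, ((H.isUniversal_iff U).1 hU).1, leftOperator_tmul,
        slice_mul_eq_comp, comulLeft_apply, comulLeft_apply, comulLeft_apply, map_mul,
        mul_lmul_apply]

end AlgebraicQuantumGroup

end QuantumGroup

theorem mainTheorem4 {A : Type*} [NonUnitalRing A] [Module ℂ A] [IsScalarTower ℂ A A]
    [SMulCommClass ℂ A A] (H : QuantumGroup.AlgebraicQuantumGroup A) :
    (∃! U : QuantumGroup.Mult (A ⊗[ℂ] H.dual), H.IsUniversal U) ∧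
    ∀ U : QuantumGroup.Mult (A ⊗[ℂ] H.dual), H.IsUniversal U →
      IsUnit U ∧
      H.IsCorepresentation U ∧
      ∀ ω : H.dual,
        QuantumGroup.IsLeftSlice U ω.1 (QuantumGroup.Mult.incl H.dual ω).lmul ∧
        H.rep U ω = QuantumGroup.Mult.incl H.dual ω := by
  obtain ⟨U₀, hU₀, hunit⟩ := H.exists_isUniversal_isUnit
  refine ⟨⟨U₀, hU₀, fun V hV => hV.eq hU₀⟩, fun U hU => ⟨?_, hU.isCorepresentation, fun ω =>
    ⟨hU.isLeftSlice ω, hU.rep_eq ω⟩⟩⟩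
  rwa [hU.eq hU₀]
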